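/- Let $n\ge 1$ and let $\mathcal S_1,\dots,\mathcal S_n$ be disjoint finite sets. Let $\{\varphi(t)\}_{t\ge 0}$ be a time-homogeneous (right-continuous) Markov jump process on the finite state space $\{\star\}\cup\mathcal S_1\cup\cdots\cup\mathcal S_n$, where $\star$ is absorbing and every state of $\mathcal S_1\cup\cdots\cup\mathcal S_n$ is transient. Assume that its generator $\Lambda$ is block bidiagonal: for each $k$ the block of $\Lambda$ on $\mathcal S_k\times\mathcal S_k$ is a square matrix $A_k$; for $k<n$ the block on $\mathcal S_k\times\mathcal S_{k+1}$ is a matrix $D_k$; the column of rates from $\mathcal S_n$ to $\star$ is $D_n\mathbf 1$, where $D_n$ is a real matrix with rows indexed by $\mathcal S_n$ and any finite number of columns; and all other entries of $\Lambda$ are zero. Assume that the process starts in $\mathcal S_1$ according to the probability (row) vector $\boldsymbol\alpha$, i.e. $\mathbb P(\varphi(0)=i)=\alpha_i$ for $i\in\mathcal S_1$ and $\sum_{i\in\mathcal S_1}\alpha_i=1$. Let $$Y_k=\int_0^\infty \mathbf 1_{\{\varphi(s)\in\mathcal S_k\}}\,ds,\qquad k=1,\dots,n,$$ be the time that the process spends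 in $\mathcal S_k$. Then $Y_1,\dots,Y_n$ are almost surely finite, and the random vector $(Y_1,\dots,Y_n)$ has a joint density with respect to Lebesgue measure on $\mathbb R^n$, given by $$f(y_1,\dots,y_n)=\boldsymbol\alpha\, e^{A_1y_1}D_1\,e^{A_2y_2}D_2\cdots e^{A_ny_n}D_n\,\mathbf 1\ \ (\ge 0)$$ for $y_1,\dots,y_n\ge 0$, and by $0$ elsewhere. Here $\mathbf 1$ is a column vector of ones. -/

import Mathlib

open MeasureTheory
open scoped NNReal ENNReal Matrix

namespace MultPH

/-! ### Finite-state Markov jump processes -/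

section MarkovJump

variable {E : Type*} [Fintype E] [DecidableEq E]

/-- `Λ` is the generator of a (conservative) Markov jump process on the finite set `E`:
nonnegative rates off the diagonal, and rows that sum to zero. -/
structure IsGenerator (Λ : Matrix E E ℝ) : Prop where
  rate_nonneg : ∀ i j, i ≠ j → 0 ≤ Λ i j
  row_sum : ∀ i, ∑ j, Λ i j = 0

/-- The transition matrix `e^{tΛ}` over a time span `t`. -/
noncomputable def transition (Λ : Matrix E E ℝ) (t : ℝ) : Matrix E E ℝ :=
  NormedSpace.exp (t • Λ)

/-- The state `i` is transient: the expected total time spent in `i` by the process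
started in `i`, that is `∫₀^∞ (e^{tΛ})ᵢᵢ dt`, is finite. -/
def IsTransient (Λ : Matrix E E ℝ) (i : E) : Prop :=
  IntegrableOn (fun t : ℝ => transition Λ t i i) (Set.Ici 0)

/-- `X` is a time-homogeneous Markov jump process on the finite set `E` with generator `Λ` and
initial distribution `π`, on the probability space `(Ω, P)`. -/
structure IsMarkovJumpProcess {Ω : Type*} [MeasurableSpace Ω] (P : Measure Ω)
    (Λ : Matrix E E ℝ) (π : E → ℝ) (X : ℝ≥0 → Ω → E) : Prop where
  measurable : ∀ t i, MeasurableSet {ω | X t ω = i}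
  /-- almost every path is right-continuous for the discrete topology of `E` -/
  right_continuous : ∀ᵐ ω ∂P, ∀ t : ℝ≥0, ∃ ε : ℝ≥0, 0 < ε ∧
    ∀ s, t ≤ s → s < t + ε → X s ω = X t ω
  initial : ∀ i, P.real {ω | X 0 ω = i} = π i
  /-- the Markov property `P(X_{t_m + h} = j | X_{t_0} = x_0, …, X_{t_m} = x_m) = (e^{hΛ})_{x_m j}`
  for `t_0 ≤ ⋯ ≤ t_m`, with the conditioning event multiplied out -/
  markov : ∀ (m : ℕ) (t : Fin (m + 1) → ℝ≥0), Monotone t →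
    ∀ (x : Fin (m + 1) → E) (h : ℝ≥0) (j : E),
      P.real {ω | (∀ r, X (t r) ω = x r) ∧ X (t (Fin.last m) + h) ω = j} =
        P.real {ω | ∀ r, X (t r) ω = x r} * transition Λ h (x (Fin.last m)) j

end MarkovJump

/-! ### The sequential class

The blocks are `S 0, …, S (n-1)`. The extra index set `S n` only labels the columns of the last
matrix `D (n-1)`, which enters the model through its row sums alone. -/

section Sequential

variable {n : ℕ} {S : Fin (n + 1) → Type*}

/-- The state space `{⋆} ∪ S 0 ∪ ⋯ ∪ S (n-1)` (disjoint union), with `⋆ = none`. -/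
abbrev State (S : Fin (n + 1) → Type*) : Type _ :=
  Option (Σ k : Fin n, S k.castSucc)

/-- The set of states that lie in the `k`-th block. -/
def block (S : Fin (n + 1) → Type*) (k : Fin n) : Set (State S) :=
  {x | ∃ i : S k.castSucc, x = some ⟨k, i⟩}

/-- The block bidiagonal generator: `A k` on the diagonal, `D k` from block `k` to block `k + 1`,
the row sums of the last `D` as rates from the last block to `⋆`, and a zero row at `⋆`. -/
def gen [∀ k, Fintype (S k)]
    (A : ∀ k : Fin n, Matrix (S k.castSucc) (S k.castSucc) ℝ)
    (D : ∀ k : Fin n, Matrix (S k.castSucc) (S k.succ) ℝ) :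
    Matrix (State S) (State S) ℝ
  | none, _ => 0
  | some ⟨k, i⟩, none => if k.succ = Fin.last n then ∑ j, D k i j else 0
  | some ⟨k, i⟩, some ⟨l, j⟩ =>
    if h : l.castSucc = k.castSucc then A k i (cast (congrArg S h) j)
    else if h : l.castSucc = k.succ then D k i (cast (congrArg S h) j)
    else 0

/-- The initial vector `[0 | α 0 ⋯ 0]`. -/
def init (α : S 0 → ℝ) : State S → ℝ
  | none => 0
  | some ⟨k, i⟩ => if h : k.castSucc = 0 then α (cast (congrArg S h) i) else 0

/-- The time `∫₀^∞ 1{X_s ∈ S k} ds ∈ [0, ∞]` spent by `X` in the `k`-th block. -/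
noncomputable def occupation {Ω : Type*} (X : ℝ≥0 → Ω → State S) (k : Fin n) (ω : Ω) : ℝ≥0∞ :=
  ∫⁻ s in Set.Ici (0 : ℝ), (block S k).indicator (fun _ => (1 : ℝ≥0∞)) (X s.toNNReal ω)

/-- The row vector `α e^{A 0 y 0} D 0 ⋯ e^{A (k-1) y (k-1)} D (k-1)`, indexed by `S k`. -/
noncomputable def rowProd [∀ k, Fintype (S k)] [∀ k, DecidableEq (S k)]
    (α : S 0 → ℝ)
    (A : ∀ k : Fin n, Matrix (S k.castSucc) (S k.castSucc) ℝ)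
    (D : ∀ k : Fin n, Matrix (S k.castSucc) (S k.succ) ℝ)
    (y : Fin n → ℝ) (k : Fin (n + 1)) : S k → ℝ :=
  Fin.induction (motive := fun k => S k → ℝ) α
    (fun k v => (v ᵥ* NormedSpace.exp (y k • A k)) ᵥ* D k) k

/-- `f(y) = α e^{A 0 y 0} D 0 ⋯ e^{A (n-1) y (n-1)} D (n-1) 1`. -/
noncomputable def jointDensity [∀ k, Fintype (S k)] [∀ k, DecidableEq (S k)]
    (α : S 0 → ℝ)
    (A : ∀ k : Fin n, Matrix (S k.castSucc) (S k.castSucc) ℝ)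
    (D : ∀ k : Fin n, Matrix (S k.castSucc) (S k.succ) ℝ)
    (y : Fin n → ℝ) : ℝ :=
  rowProd α A D y (Fin.last n) ⬝ᵥ 1

end Sequential

end MultPH

/-! Give each state the index of its block as level, with `⋆` on top. The level can only grow, by
one at a time, so the occupation times are the increments of the exit times T_k = Y_0 + ⋯ + Y_k. For
0 = b_0 ≤ a_0 ≤ b_1 ≤ a_1 ≤ ⋯, the event that a_k < T_k ≤ b_{k+1} for all k is, almost surely, the
event that the level is k at the times b_k and a_k (`exitTimes_mem_pi_Ioc_iff`). It involves
finitely many times, so the Markov property at fixed times gives its probability (`gridRow_eq`);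
neither jump times nor the strong Markov property enter.

The candidate density gives the same mass to the corresponding set `sumBox`. While the process sits
at level m, the flux out of that level is minus the derivative of the probability of still being
there (`hasDerivAt_level`). The fundamental theorem of calculus therefore integrates out one sojourn
time after another (`lintegral_exitRate`, `setLIntegral_sumBox`).

Such ordered boxes do not generate all Borel sets, but countably many of them cover the partial sums
of strictly positive vectors, and the two laws agree on that cover (`restrict_iUnion_eq_of_pi_Ioc`).
The density has total mass one: each sojourn integral over the half-line telescopes, because
transience makes the probability of a level below n tend to zero (`tendsto_transition`,
`setLIntegral_nonneg_pathRow`). Hence both laws live on the cover and coincide (`map_exitTimes`);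
passing to increments gives the law of the occupation times.

All this is done with the full exponential of the generator. Only its diagonal blocks contribute to
the density, and by block triangularity these are the exponentials of the A_k
(`transition_apply_of_level_eq`). -/

namespace MultPH

open Filter Topology

/-! ### Transition semigroups of finite generators -/

section Transition

variable {E : Type*} [Fintype E] [DecidableEq E]

@[simp] theorem transition_zero (Λ : Matrix E E ℝ) : transition Λ 0 = 1 := by
  simp [transition]

theorem transition_add (Λ : Matrix E E ℝ) (s t : ℝ) :
    transition Λ (s + t) = transition Λ s * transition Λ t := by
  unfold transition
  rw [add_smul]
  exact Matrix.exp_add_of_commute _ _ (((Commute.refl Λ).smul_left s).smul_right t)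

open scoped Matrix.Norms.Operator in
theorem hasDerivAt_transition (Λ : Matrix E E ℝ) (t : ℝ) :
    HasDerivAt (transition Λ) (transition Λ t * Λ) t :=
  hasDerivAt_exp_smul_const (𝕂 := ℝ) Λ t

open scoped Matrix.Norms.Operator in
theorem transition_mul_comm (Λ : Matrix E E ℝ) (t : ℝ) :
    transition Λ t * Λ = Λ * transition Λ t :=
  (hasDerivAt_transition Λ t).unique (hasDerivAt_exp_smul_const' (𝕂 := ℝ) Λ t)

@[fun_prop]
theorem continuous_transition (Λ : Matrix E E ℝ) : Continuous (transition Λ) := by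
  open scoped Matrix.Norms.Operator in
  exact continuous_iff_continuousAt.2 fun t => (hasDerivAt_transition Λ t).continuousAt

/-- The exponential series, entry by entry. -/
theorem hasSum_exp_apply (M : Matrix E E ℝ) (i j : E) :
    HasSum (fun p : ℕ => ((p.factorial : ℝ)⁻¹) * (M ^ p) i j) (NormedSpace.exp M i j) := by
  open scoped Matrix.Norms.Operator in
  exact (NormedSpace.exp_series_hasSum_exp' (𝕂 := ℝ) M).map (Matrix.entryAddMonoidHom ℝ i j)
    (continuous_apply_apply i j)

theorem exp_apply_nonneg {M : Matrix E E ℝ} (hM : ∀ i j, 0 ≤ M i j) (i j : E) :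
    0 ≤ NormedSpace.exp M i j := by
  have hp : ∀ (p : ℕ) (i j : E), 0 ≤ (M ^ p) i j := by
    intro p
    induction p with
    | zero => intro i j; by_cases h : i = j <;> simp [h]
    | succ p ih =>
      intro i j
      rw [pow_succ, Matrix.mul_apply]
      exact Finset.sum_nonneg fun k _ => mul_nonneg (ih i k) (hM k j)
  exact (hasSum_exp_apply M i j).nonneg fun p => mul_nonneg (by positivity) (hp p i j)

/-- Uniformization: adding a large multiple c of the identity makes the generator entrywise
nonnegative, and it changes the exponential only by the positive scalar factor e^{tc}. -/
theorem IsGenerator.transition_nonneg {Λ : Matrix E E ℝ} (hΛ : IsGenerator Λ) {t : ℝ}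
    (ht : 0 ≤ t) (i j : E) : 0 ≤ transition Λ t i j := by
  set c : ℝ := ∑ i, |Λ i i| with hc
  have hsplit : transition Λ t =
      NormedSpace.exp (t • (Λ + c • (1 : Matrix E E ℝ))) *
        NormedSpace.exp ((-(t * c)) • (1 : Matrix E E ℝ)) := by
    rw [← Matrix.exp_add_of_commute]
    · rw [smul_add, smul_smul, neg_smul, add_neg_cancel_right]
      rfl
    · exact (Commute.one_right _).smul_right _
  have hdiag : NormedSpace.exp ((-(t * c)) • (1 : Matrix E E ℝ)) =
      Matrix.diagonal fun _ => Real.exp (-(t * c)) := by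
    rw [Matrix.smul_one_eq_diagonal, Matrix.exp_diagonal]
    congr 1
    ext i
    rw [Pi.coe_exp, Real.exp_eq_exp_ℝ]
  rw [hsplit, hdiag, Matrix.mul_diagonal]
  refine mul_nonneg (exp_apply_nonneg (fun i j => ?_) i j) (Real.exp_pos _).le
  refine mul_nonneg ht ?_
  by_cases h : i = j
  · subst h
    have h1 : |Λ i i| ≤ c := Finset.single_le_sum (f := fun i => |Λ i i|)
      (fun _ _ => abs_nonneg _) (Finset.mem_univ i)
    have := neg_abs_le (Λ i i)
    simp
    linarith
  · simpa [h] using hΛ.rate_nonneg i j h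

theorem IsGenerator.transition_mulVec_one {Λ : Matrix E E ℝ} (hΛ : IsGenerator Λ) (t : ℝ) :
    transition Λ t *ᵥ 1 = 1 := by
  have h1 : (t • Λ) *ᵥ 1 = 0 := by
    ext i
    simp [Matrix.mulVec, dotProduct, ← Finset.mul_sum, hΛ.row_sum i]
  have hp : ∀ p : ℕ, ((t • Λ) ^ (p + 1)) *ᵥ (1 : E → ℝ) = 0 := by
    intro p
    rw [pow_succ, ← Matrix.mulVec_mulVec, h1, Matrix.mulVec_zero]
  ext i
  have hs : HasSum (fun p : ℕ => ((p.factorial : ℝ)⁻¹) * (((t • Λ) ^ p) *ᵥ (1 : E → ℝ)) i)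
      ((transition Λ t *ᵥ 1) i) := by
    have := hasSum_sum (s := Finset.univ) fun j _ => hasSum_exp_apply (t • Λ) i j
    simpa [Matrix.mulVec, dotProduct, Finset.mul_sum, transition] using this
  refine hs.unique ?_
  have := hasSum_single (f := fun p : ℕ =>
    ((p.factorial : ℝ)⁻¹) * (((t • Λ) ^ p) *ᵥ (1 : E → ℝ)) i) 0 (fun p hp0 => ?_)
  · simpa using this
  · obtain ⟨q, rfl⟩ := Nat.exists_eq_succ_of_ne_zero hp0
    simp [hp q]

theorem IsGenerator.sum_transition {Λ : Matrix E E ℝ} (hΛ : IsGenerator Λ) (t : ℝ) (i : E) :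
    ∑ j, transition Λ t i j = 1 := by
  simpa [Matrix.mulVec, dotProduct] using congrFun (hΛ.transition_mulVec_one t) i

theorem blockTriangular_transition {Λ : Matrix E E ℝ} {ℓ : E → ℕ} (h : Λ.BlockTriangular ℓ)
    (t : ℝ) : (transition Λ t).BlockTriangular ℓ := by
  refine Matrix.BlockTriangular.exp fun i j hij => ?_
  simp [h hij]

/-- The diagonal blocks of the exponential of a block triangular matrix are the exponentials of
its diagonal blocks. -/
theorem transition_apply_of_level_eq {F : Type*} [Fintype F] [DecidableEq F]
    {Λ : Matrix E E ℝ} {ℓ : E → ℕ} (h : Λ.BlockTriangular ℓ) (e : F ↪ E) (m : ℕ)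
    (he : ∀ x, ℓ x = m ↔ x ∈ Set.range e) (t : ℝ) (i j : F) :
    transition Λ t (e i) (e j) = NormedSpace.exp (t • Λ.submatrix e e) i j := by
  have hpow : ∀ (p : ℕ), ((t • Λ) ^ p).BlockTriangular ℓ := by
    intro p
    induction p with
    | zero => simpa using Matrix.blockTriangular_one
    | succ p ih =>
      rw [pow_succ]
      exact ih.mul fun i j hij => by simp [h hij]
  have key : ∀ (p : ℕ) (i j : F), ((t • Λ) ^ p) (e i) (e j) =
      ((t • Λ.submatrix e e) ^ p) i j := by
    intro p
    induction p with
    | zero => intro i j; simp [Matrix.one_apply]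
    | succ p ih =>
      intro i j
      rw [pow_succ, pow_succ, Matrix.mul_apply, Matrix.mul_apply]
      rw [← Finset.sum_subset (Finset.subset_univ (Finset.univ.map e)), Finset.sum_map]
      · simp [ih]
      · intro x _ hx
        have hxm : ℓ x ≠ m := fun hc => hx (by simpa using (he x).1 hc)
        have hi : ℓ (e i) = m := (he _).2 ⟨i, rfl⟩
        have hj : ℓ (e j) = m := (he _).2 ⟨j, rfl⟩
        -- A detour through another level contributes nothing: a lower level cannot be reached from
        -- level m, and a higher one cannot return to it.
        rcases lt_or_gt_of_ne hxm with hlt | hgt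
        · rw [hpow p (show ℓ x < ℓ (e i) by omega), zero_mul]
        · rw [Matrix.smul_apply, h (show ℓ (e j) < ℓ x by omega), smul_zero, mul_zero]
  refine (hasSum_exp_apply (t • Λ) (e i) (e j)).unique ?_
  simpa [key] using hasSum_exp_apply (t • Λ.submatrix e e) i j

end Transition

/-! ### Levels, transience and escape to the top level -/

section Sequential

variable {E : Type*} [Fintype E] [DecidableEq E]

/-- A generator whose states carry levels `0, …, n` such that the level can only grow, by one at
a time, and such that the states of level less than `n` are transient. -/
structure IsSequentialGenerator (Λ : Matrix E E ℝ) (ℓ : E → ℕ) (n : ℕ) : Prop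
    extends IsGenerator Λ where
  step : ∀ i j, ℓ j ≠ ℓ i → ℓ j ≠ ℓ i + 1 → Λ i j = 0
  level_le : ∀ i, ℓ i ≤ n
  transient : ∀ i, ℓ i < n → IsTransient Λ i

namespace IsSequentialGenerator

variable {Λ : Matrix E E ℝ} {ℓ : E → ℕ} {n : ℕ}

theorem blockTriangular (h : IsSequentialGenerator Λ ℓ n) : Λ.BlockTriangular ℓ :=
  fun i j hij => h.step i j (by omega) (by omega)

theorem transition_eq_zero (h : IsSequentialGenerator Λ ℓ n) (t : ℝ) {i j : E}
    (hij : ℓ j < ℓ i) : transition Λ t i j = 0 :=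
  blockTriangular_transition h.blockTriangular t hij

end IsSequentialGenerator

theorem IsGenerator.transition_mul_le {Λ : Matrix E E ℝ} (hΛ : IsGenerator Λ) {s t : ℝ}
    (hs : 0 ≤ s) (ht : 0 ≤ t) (i j k : E) :
    transition Λ s i j * transition Λ t j k ≤ transition Λ (s + t) i k := by
  rw [transition_add, Matrix.mul_apply]
  exact Finset.single_le_sum (f := fun j => transition Λ s i j * transition Λ t j k)
    (fun j _ => mul_nonneg (hΛ.transition_nonneg hs i j) (hΛ.transition_nonneg ht j k))
    (Finset.mem_univ j)

/-- If `k` leads to the transient state `j`, the time spent in `k` starting from `j` is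
integrable. -/
theorem IsGenerator.integrableOn_transition {Λ : Matrix E E ℝ} (hΛ : IsGenerator Λ) {j k : E}
    (hj : IsTransient Λ j) {s : ℝ} (hs : 0 ≤ s) (hkj : 0 < transition Λ s k j) :
    IntegrableOn (fun t => transition Λ t j k) (Set.Ici 0) := by
  have h1 : IntegrableOn (fun t => transition Λ (t + s) j j) (Set.Ici 0) := by
    have h2 := (measurePreserving_add_right (volume : Measure ℝ) s).integrableOn_comp_preimage
      (measurableEmbedding_addRight s) (f := fun t => transition Λ t j j) (s := Set.Ici s)
    have h3 : (fun x => x + s) ⁻¹' Set.Ici s = Set.Ici (0 : ℝ) := by ext; simp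
    rw [h3] at h2
    exact h2.2 (hj.mono_set (Set.Ici_subset_Ici.2 hs))
  -- Domination by returns to j: going from j to k in time t and back in time s is one way to be at
  -- j at time t + s.
  refine (h1.const_mul (transition Λ s k j)⁻¹).mono' ?_ ?_
  · exact ((continuous_apply_apply j k).comp (continuous_transition Λ)).aestronglyMeasurable
  · refine (ae_restrict_iff' measurableSet_Ici).2 (.of_forall fun t ht => ?_)
    have ht : 0 ≤ t := ht
    rw [Real.norm_of_nonneg (hΛ.transition_nonneg ht j k), inv_mul_eq_div, le_div_iff₀ hkj]
    exact hΛ.transition_mul_le ht hs j k j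

/-- The set of states that can be reached from `i`. -/
noncomputable def reachable (Λ : Matrix E E ℝ) (i : E) : Finset E :=
  open scoped Classical in Finset.univ.filter fun j => ∃ t : ℝ, 0 ≤ t ∧ 0 < transition Λ t i j

theorem mem_reachable {Λ : Matrix E E ℝ} {i j : E} :
    j ∈ reachable Λ i ↔ ∃ t : ℝ, 0 ≤ t ∧ 0 < transition Λ t i j := by
  simp [reachable]

theorem self_mem_reachable (Λ : Matrix E E ℝ) (i : E) : i ∈ reachable Λ i :=
  mem_reachable.2 ⟨0, le_rfl, by simp⟩

theorem IsGenerator.reachable_subset {Λ : Matrix E E ℝ} (hΛ : IsGenerator Λ) {i j : E}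
    (h : j ∈ reachable Λ i) : reachable Λ j ⊆ reachable Λ i := by
  intro k hk
  obtain ⟨s, hs, hs'⟩ := mem_reachable.1 h
  obtain ⟨t, ht, ht'⟩ := mem_reachable.1 hk
  exact mem_reachable.2 ⟨s + t, add_nonneg hs ht,
    (mul_pos hs' ht').trans_le (hΛ.transition_mul_le hs ht i j k)⟩

/-- A state from which only transient states can be reached does not exist. -/
theorem IsGenerator.exists_reachable_not_isTransient {Λ : Matrix E E ℝ} (hΛ : IsGenerator Λ)
    (i : E) : ∃ j ∈ reachable Λ i, ¬ IsTransient Λ j := by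
  by_contra! hcon
  -- A reachable set of minimal size is a closed communicating class. If its states were all
  -- transient, the row of j, which sums to one at every time, would be integrable over the
  -- half-line.
  obtain ⟨j, hji, hmin⟩ := Finset.exists_min_image (reachable Λ i)
    (fun j => (reachable Λ j).card) ⟨i, self_mem_reachable Λ i⟩
  have hint : ∀ k ∈ reachable Λ j, IntegrableOn (fun t => transition Λ t j k) (Set.Ici 0) := by
    intro k hk
    have hsub := hΛ.reachable_subset hk
    have heq : reachable Λ k = reachable Λ j :=
      Finset.eq_of_subset_of_card_le hsub (hmin k (hΛ.reachable_subset hji hk))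
    obtain ⟨s, hs, hs'⟩ := mem_reachable.1 (heq ▸ self_mem_reachable Λ j : j ∈ reachable Λ k)
    exact hΛ.integrableOn_transition (hcon j hji) hs hs'
  have hsum : IntegrableOn (fun _ : ℝ => (1 : ℝ)) (Set.Ici 0) := by
    refine (integrable_finsetSum (reachable Λ j) hint).congr ?_
    refine (ae_restrict_iff' measurableSet_Ici).2 (.of_forall fun t ht => ?_)
    have ht : 0 ≤ t := ht
    rw [← hΛ.sum_transition t j]
    refine Finset.sum_subset (Finset.subset_univ _) fun k _ hk => ?_
    refine le_antisymm (not_lt.1 fun hlt => hk (mem_reachable.2 ⟨t, ht, hlt⟩))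
      (hΛ.transition_nonneg ht j k)
  simp [integrableOn_const_iff] at hsum

namespace IsSequentialGenerator

variable {Λ : Matrix E E ℝ} {ℓ : E → ℕ} {n : ℕ}

/-- Starting from any state, the probability of being at a level less than `n` tends to zero. -/
theorem tendsto_transition (h : IsSequentialGenerator Λ ℓ n) (i : E) {j : E} (hj : ℓ j < n) :
    Tendsto (fun t => transition Λ t i j) atTop (𝓝 0) := by
  set Q := transition Λ with hQ
  have hnn : ∀ {t : ℝ}, 0 ≤ t → ∀ i j, 0 ≤ Q t i j := fun ht => h.transition_nonneg ht
  set u : ℝ → E → ℝ := fun t i => ∑ j with ℓ j < n, Q t i j with hu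
  have hu0 : ∀ t i, ℓ i = n → u t i = 0 := fun t i hi =>
    Finset.sum_eq_zero fun j hj => h.transition_eq_zero t (by simp at hj; omega)
  have hunn : ∀ {t : ℝ}, 0 ≤ t → ∀ i, 0 ≤ u t i := fun ht i =>
    Finset.sum_nonneg fun j _ => hnn ht i j
  have hu1 : ∀ {t : ℝ}, 0 ≤ t → ∀ i, u t i ≤ 1 := fun {t} ht i => by
    rw [← h.sum_transition t i]
    exact Finset.sum_le_sum_of_subset_of_nonneg (Finset.subset_univ _) fun j _ _ => hnn ht i j
  have hadd : ∀ s t i, u (s + t) i = ∑ k with ℓ k < n, Q s i k * u t k := by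
    intro s t i
    simp only [hu, hQ, transition_add, Matrix.mul_apply]
    rw [Finset.sum_comm]
    simp only [← Finset.mul_sum]
    refine (Finset.sum_subset (Finset.subset_univ _) fun k _ hk => ?_).symm
    have hk : ℓ k = n := by
      have := h.level_le k
      simp at hk
      omega
    have := hu0 t k hk
    simp only [hu, hQ] at this
    rw [this, mul_zero]
  -- Monotonicity is available only at nonnegative times, hence the truncation.
  have hanti : ∀ i, Antitone fun t => u (max t 0) i := by
    intro i s t hst
    have h1 : max t 0 = max s 0 + (max t 0 - max s 0) := by ring
    have h2 : 0 ≤ max t 0 - max s 0 := sub_nonneg.2 (max_le_max_right 0 hst)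
    simp only
    rw [h1, hadd]
    refine Finset.sum_le_sum fun k _ => ?_
    exact mul_le_of_le_one_right (hnn (le_max_right s 0) i k) (hu1 h2 k)
  have hlim : ∀ i, ∃ l, Tendsto (fun t => u t i) atTop (𝓝 l) := by
    intro i
    refine ⟨_, (tendsto_atTop_ciInf (hanti i) ⟨0, ?_⟩).congr' ?_⟩
    · rintro _ ⟨t, rfl⟩
      exact hunn (le_max_right t 0) i
    · filter_upwards [eventually_ge_atTop (0 : ℝ)] with t ht
      rw [max_eq_left ht]
  choose l hl using hlim
  have hlnn : ∀ i, 0 ≤ l i := fun i => ge_of_tendsto (hl i) <| by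
    filter_upwards [eventually_ge_atTop (0 : ℝ)] with t ht using hunn ht i
  have hharm : ∀ t i, l i = ∑ k with ℓ k < n, Q t i k * l k := by
    intro t i
    have h1 : Tendsto (fun s => u (t + s) i) atTop (𝓝 (l i)) :=
      (hl i).comp (tendsto_atTop_add_const_left _ t tendsto_id)
    simp only [hadd] at h1
    exact tendsto_nhds_unique h1 (tendsto_finsetSum _ fun k _ => (hl k).const_mul (Q t i k))
  -- Maximum principle for the limit l, which is harmonic on the levels below n. From a maximizer m
  -- some non-transient state, necessarily of level n, is reached with positive probability, so `u t
  -- m < 1` for some t, while l m ≤ `u t m` · l m.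
  have hlz : ∀ i, l i = 0 := by
    obtain ⟨m, -, hm⟩ := Finset.exists_max_image Finset.univ l ⟨i, Finset.mem_univ i⟩
    suffices hz : l m ≤ 0 from fun i =>
      le_antisymm ((hm i (Finset.mem_univ i)).trans hz) (hlnn i)
    by_contra! hpos
    obtain ⟨k, hk, hkt⟩ := h.toIsGenerator.exists_reachable_not_isTransient m
    obtain ⟨t, ht, hpk⟩ := mem_reachable.1 hk
    have hkn : ¬ ℓ k < n := fun hc => hkt (h.transient k hc)
    have hlt : u t m < 1 := by
      rw [← h.sum_transition t m]
      refine Finset.sum_lt_sum_of_subset (Finset.subset_univ _) (Finset.mem_univ k) ?_ hpk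
        fun j _ _ => hnn ht m j
      simpa using hkn
    have hle : l m ≤ u t m * l m := by
      conv_lhs => rw [hharm t m]
      rw [hu, Finset.sum_mul]
      exact Finset.sum_le_sum fun k _ =>
        mul_le_mul_of_nonneg_left (hm k (Finset.mem_univ k)) (hnn ht m k)
    nlinarith
  have hui := hlz i ▸ hl i
  refine tendsto_of_tendsto_of_tendsto_of_le_of_le' tendsto_const_nhds hui ?_ ?_
  · filter_upwards [eventually_ge_atTop (0 : ℝ)] with t ht using hnn ht i j
  · filter_upwards [eventually_ge_atTop (0 : ℝ)] with t ht
    exact Finset.single_le_sum (f := fun j => Q t i j) (fun j _ => hnn ht i j) (by simpa using hj)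

end IsSequentialGenerator

end Sequential

theorem vecMul_apply {E F : Type*} [Fintype E] (v : E → ℝ) (M : Matrix E F ℝ) (j : F) :
    (v ᵥ* M) j = ∑ i, v i * M i j := rfl

theorem mulVec_apply {E F : Type*} [Fintype F] (M : Matrix E F ℝ) (v : F → ℝ) (i : E) :
    (M *ᵥ v) i = ∑ j, M i j * v j := rfl

theorem vecMul_nonneg {E F : Type*} [Fintype E] {v : E → ℝ} (hv : ∀ i, 0 ≤ v i)
    {M : Matrix E F ℝ} (hM : ∀ i j, 0 ≤ M i j) (j : F) : 0 ≤ (v ᵥ* M) j :=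
  Finset.sum_nonneg fun i _ => mul_nonneg (hv i) (hM i j)

section ExitRate

variable {E : Type*}

/-- The rates of the jumps from level `m` to level `m + 1`. -/
def exitRate (Λ : Matrix E E ℝ) (ℓ : E → ℕ) (m : ℕ) : Matrix E E ℝ :=
  Matrix.of fun i j => if ℓ i = m ∧ ℓ j = m + 1 then Λ i j else 0

theorem IsGenerator.exitRate_nonneg [Fintype E] {Λ : Matrix E E ℝ} (hΛ : IsGenerator Λ)
    (ℓ : E → ℕ) (m : ℕ) (i j : E) : 0 ≤ exitRate Λ ℓ m i j := by
  rw [exitRate, Matrix.of_apply]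
  split_ifs with h
  · exact hΛ.rate_nonneg i j fun hij => by subst hij; omega
  · exact le_rfl

end ExitRate

/-! ### The path density and its mass over boxes of partial sums -/

section PathDensity

variable {E : Type*} [Fintype E] [DecidableEq E]

/-- The row vector `π e^{y₀Λ} D₀ ⋯ e^{y₍ₘ₋₁₎Λ} D₍ₘ₋₁₎`, where `Dₖ` holds the rates from level `k` to
level `k + 1`. -/
noncomputable def pathRow (Λ : Matrix E E ℝ) (ℓ : E → ℕ) (π : E → ℝ) :
    (m : ℕ) → (Fin m → ℝ) → E → ℝ
  | 0, _ => π
  | m + 1, y => (pathRow Λ ℓ π m (Fin.init y) ᵥ* transition Λ (y (Fin.last m))) ᵥ* exitRate Λ ℓ m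

/-- The law of the process at time `b m` on the event that it was at level `k` at the times `b k`
and `a k` for all `k < m`, and is at level `m` at time `b m`. -/
noncomputable def gridRow (Λ : Matrix E E ℝ) (ℓ : E → ℕ) (π : E → ℝ) (a b : ℕ → ℝ) :
    ℕ → E → ℝ
  | 0 => π
  | m + 1 => fun k => if ℓ k = m + 1 then
      ∑ i with ℓ i = m, (gridRow Λ ℓ π a b m ᵥ* transition Λ (a m - b m)) i *
        transition Λ (b (m + 1) - a m) i k else 0

/-- The vectors whose `k`-th partial sum lies in `(a k, b (k + 1)]`, for all `k`. -/
def sumBox (a b : ℕ → ℝ) (m : ℕ) : Set (Fin m → ℝ) :=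
  {y | ∀ k : Fin m, ∑ l ∈ Finset.Iic k, y l ∈ Set.Ioc (a k) (b (k + 1))}

variable {Λ : Matrix E E ℝ} {ℓ : E → ℕ} {n : ℕ} {π : E → ℝ} {a b : ℕ → ℝ}

theorem snoc_mem_sumBox {m : ℕ} {y : Fin m → ℝ} {t : ℝ} :
    (Fin.snoc y t : Fin (m + 1) → ℝ) ∈ sumBox a b (m + 1) ↔
      y ∈ sumBox a b m ∧ t ∈ Set.Ioc (a m - ∑ l, y l) (b (m + 1) - ∑ l, y l) := by
  have hlast : Finset.Iic (Fin.last m) = Finset.univ := by ext; simp [Fin.le_last]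
  have h (s u v : ℝ) : (s + t ∈ Set.Ioc u v) ↔ t ∈ Set.Ioc (u - s) (v - s) := by
    simp only [Set.mem_Ioc]
    constructor <;> rintro ⟨h1, h2⟩ <;> constructor <;> linarith
  simp only [sumBox, Set.mem_ofPred_eq, Fin.forall_fin_succ', Fin.sum_Iic_castSucc,
    Fin.snoc_castSucc, hlast, Fin.sum_univ_castSucc, Fin.snoc_last, Fin.val_castSucc,
    Fin.val_last, h]

theorem sum_le_of_mem_sumBox (hb : b 0 = 0) {m : ℕ} {y : Fin m → ℝ} (hy : y ∈ sumBox a b m) :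
    ∑ l, y l ≤ b m := by
  cases m with
  | zero => simp [hb]
  | succ m =>
    have hlast : Finset.Iic (Fin.last m) = Finset.univ := by ext; simp [Fin.le_last]
    have := (hy (Fin.last m)).2
    rwa [hlast] at this

theorem nonneg_of_mem_sumBox (hb : b 0 = 0) (hba : ∀ k, b k ≤ a k) {m : ℕ} {y : Fin m → ℝ}
    (hy : y ∈ sumBox a b m) : ∀ k, 0 ≤ y k := by
  induction m with
  | zero => exact fun k => k.elim0
  | succ m ih =>
    rw [← Fin.snoc_init_self y, snoc_mem_sumBox] at hy
    refine Fin.lastCases ?_ fun k => ih hy.1 k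
    have := sum_le_of_mem_sumBox hb hy.1
    linarith [hy.2.1, hba m]

theorem measurableSet_sumBox (a b : ℕ → ℝ) (m : ℕ) : MeasurableSet (sumBox a b m) := by
  have : sumBox a b m = ⋂ k : Fin m,
      {y : Fin m → ℝ | ∑ l ∈ Finset.Iic k, y l ∈ Set.Ioc (a k) (b (k + 1))} := by
    ext y
    simp [sumBox]
  rw [this]
  refine MeasurableSet.iInter fun k => ?_
  exact (Finset.measurable_sum _ fun l _ => measurable_pi_apply l) measurableSet_Ioc

theorem lintegral_snoc {m : ℕ} {F : (Fin (m + 1) → ℝ) → ℝ≥0∞} (hF : Measurable F) :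
    ∫⁻ y, F y = ∫⁻ y : Fin m → ℝ, ∫⁻ t : ℝ, F (Fin.snoc y t) := by
  have e := volume_preserving_piFinSuccAbove (fun _ : Fin (m + 1) => ℝ) (Fin.last m)
  rw [← e.symm.lintegral_comp hF, Measure.volume_eq_prod, lintegral_prod_symm]
  · simp [MeasurableEquiv.piFinSuccAbove, Fin.snocEquiv]
  · exact (hF.comp (MeasurableEquiv.measurable _)).aemeasurable

/-- Iterated integration over a set of the form `{y | init y ∈ s ∧ y (last m) ∈ t (init y)}`. -/
theorem setLIntegral_snoc {m : ℕ} {F : (Fin (m + 1) → ℝ) → ℝ≥0∞} (hF : Measurable F)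
    {u : Set (Fin (m + 1) → ℝ)} (hu : MeasurableSet u) {s : Set (Fin m → ℝ)}
    (hs : MeasurableSet s) {v : (Fin m → ℝ) → Set ℝ} (hv : ∀ y, MeasurableSet (v y))
    (h : ∀ y t, (Fin.snoc y t : Fin (m + 1) → ℝ) ∈ u ↔ y ∈ s ∧ t ∈ v y) :
    ∫⁻ y in u, F y = ∫⁻ y in s, ∫⁻ t in v y, F (Fin.snoc y t) := by
  rw [← lintegral_indicator hu, lintegral_snoc (hF.indicator hu), ← lintegral_indicator hs]
  refine lintegral_congr fun y => ?_
  by_cases hy : y ∈ s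
  · rw [Set.indicator_of_mem hy, ← lintegral_indicator (hv y)]
    refine lintegral_congr fun t => ?_
    by_cases ht : t ∈ v y
    · rw [Set.indicator_of_mem ht, Set.indicator_of_mem ((h y t).2 ⟨hy, ht⟩)]
    · rw [Set.indicator_of_notMem ht, Set.indicator_of_notMem fun hc => ht ((h y t).1 hc).2]
  · rw [Set.indicator_of_notMem hy]
    refine (lintegral_congr fun t => ?_).trans lintegral_zero
    rw [Set.indicator_of_notMem fun hc => hy ((h y t).1 hc).1]

theorem continuous_pathRow (Λ : Matrix E E ℝ) (ℓ : E → ℕ) (π : E → ℝ) (m : ℕ) :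
    Continuous (pathRow Λ ℓ π m) := by
  induction m with
  | zero => exact continuous_const
  | succ m ih =>
    have h1 : Continuous fun y : Fin (m + 1) → ℝ => pathRow Λ ℓ π m (Fin.init y) :=
      ih.comp (continuous_pi fun k => continuous_apply _)
    have h2 : Continuous fun y : Fin (m + 1) → ℝ => transition Λ (y (Fin.last m)) :=
      (continuous_transition Λ).comp (continuous_apply _)
    exact (h1.matrix_vecMul h2).matrix_vecMul continuous_const

theorem pathRow_snoc {m : ℕ} (y : Fin m → ℝ) (t : ℝ) :
    pathRow Λ ℓ π (m + 1) (Fin.snoc y t) =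
      (pathRow Λ ℓ π m y ᵥ* transition Λ t) ᵥ* exitRate Λ ℓ m := by
  simp [pathRow]

theorem pathRow_eq_zero (hπ : ∀ i, ℓ i ≠ 0 → π i = 0) {m : ℕ} (y : Fin m → ℝ) {j : E}
    (hj : ℓ j ≠ m) : pathRow Λ ℓ π m y j = 0 := by
  cases m with
  | zero => exact hπ j hj
  | succ m => simp [pathRow, exitRate, vecMul_apply, hj]

theorem IsGenerator.pathRow_nonneg (hΛ : IsGenerator Λ) (hπ : ∀ i, 0 ≤ π i) {m : ℕ}
    {y : Fin m → ℝ} (hy : ∀ k, 0 ≤ y k) (j : E) : 0 ≤ pathRow Λ ℓ π m y j := by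
  induction m generalizing j with
  | zero => exact hπ j
  | succ m ih =>
    exact vecMul_nonneg (vecMul_nonneg (fun i => ih (fun k => hy _) i)
      (hΛ.transition_nonneg (hy _))) (hΛ.exitRate_nonneg ℓ m) j

theorem IsGenerator.gridRow_nonneg (hΛ : IsGenerator Λ) (hπ : ∀ i, 0 ≤ π i)
    (hba : ∀ k, b k ≤ a k) (hab : ∀ k, a k ≤ b (k + 1)) (m : ℕ) (j : E) :
    0 ≤ gridRow Λ ℓ π a b m j := by
  induction m generalizing j with
  | zero => exact hπ j
  | succ m ih =>
    simp only [gridRow]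
    split_ifs
    · exact Finset.sum_nonneg fun i _ => mul_nonneg
        (vecMul_nonneg ih (hΛ.transition_nonneg (sub_nonneg.2 (hba m))) i)
        (hΛ.transition_nonneg (sub_nonneg.2 (hab m)) i j)
    · exact le_rfl

namespace IsSequentialGenerator

theorem vecMul_transition_eq_zero (h : IsSequentialGenerator Λ ℓ n) {m : ℕ} {v : E → ℝ}
    (hv : ∀ i, ℓ i ≠ m → v i = 0) (t : ℝ) {j : E} (hj : ℓ j < m) :
    (v ᵥ* transition Λ t) j = 0 := by
  rw [vecMul_apply]
  refine Finset.sum_eq_zero fun i _ => ?_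
  by_cases hi : ℓ i = m
  · rw [h.transition_eq_zero t (by omega), mul_zero]
  · rw [hv i hi, zero_mul]

/-- Balance of flux through level m. The product rule yields pΛ against q minus p against Λq, both
restricted to level m; rates inside the level cancel. There is no inflow, since a start on level m
puts no mass below it, so only the jumps to level m + 1 remain. The test vector w is a unit vector
for box masses and the vector of ones for total mass. -/
theorem hasDerivAt_level (h : IsSequentialGenerator Λ ℓ n) {m : ℕ} {v : E → ℝ}
    (hv : ∀ i, ℓ i ≠ m → v i = 0) (w : E → ℝ) (d t : ℝ) :
    HasDerivAt
      (fun t => ∑ k with ℓ k = m, (v ᵥ* transition Λ t) k * (transition Λ (d - t) *ᵥ w) k)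
      (-(((v ᵥ* transition Λ t) ᵥ* exitRate Λ ℓ m) ⬝ᵥ (transition Λ (d - t) *ᵥ w))) t := by
  have hentry : ∀ (t : ℝ) (i j : E),
      HasDerivAt (fun t => transition Λ t i j) ((transition Λ t * Λ) i j) t := by
    intro t i j
    open scoped Matrix.Norms.Operator in
    exact hasDerivAt_pi.1 (hasDerivAt_pi.1 (hasDerivAt_transition Λ t) i) j
  have hp : ∀ k, HasDerivAt (fun t => (v ᵥ* transition Λ t) k)
      (((v ᵥ* transition Λ t) ᵥ* Λ) k) t := by
    intro k
    rw [Matrix.vecMul_vecMul]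
    exact HasDerivAt.fun_sum fun i _ => (hentry t i k).const_mul (v i)
  have hq : ∀ k, HasDerivAt (fun t => (transition Λ (d - t) *ᵥ w) k)
      (-((Λ *ᵥ (transition Λ (d - t) *ᵥ w)) k)) t := by
    intro k
    rw [Matrix.mulVec_mulVec, ← transition_mul_comm]
    have : HasDerivAt (fun t => ∑ j, transition Λ (d - t) k j * w j)
      (∑ j, -((transition Λ (d - t) * Λ) k j) * w j) t :=
      HasDerivAt.fun_sum fun j _ => by
        have h1 := ((hentry (d - t) k j).comp t ((hasDerivAt_id t).const_sub d))
        simpa [Function.comp_def] using h1.mul_const (w j)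
    refine this.congr_deriv ?_
    rw [mulVec_apply, ← Finset.sum_neg_distrib]
    exact Finset.sum_congr rfl fun j _ => neg_mul _ _
  refine (HasDerivAt.fun_sum fun k _ => (hp k).mul (hq k)).congr_deriv ?_
  set p := v ᵥ* transition Λ t with hpdef
  set q := transition Λ (d - t) *ᵥ w
  have hp0 : ∀ i, ℓ i < m → p i = 0 := fun i hi => h.vecMul_transition_eq_zero hv t hi
  -- Written as a sum over transitions i → k, each weighted by +1 for entering level m and −1 for
  -- leaving it.
  have e1 : ∑ k with ℓ k = m, ((p ᵥ* Λ) k * q k + p k * -((Λ *ᵥ q) k)) =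
      ∑ i, ∑ k, p i * Λ i k * q k * ((if ℓ k = m then 1 else 0) - if ℓ i = m then 1 else 0) := by
    simp only [mul_sub, Finset.sum_sub_distrib, mul_neg, ← sub_eq_add_neg]
    congr 1
    · rw [Finset.sum_comm, Finset.sum_filter]
      refine Finset.sum_congr rfl fun k _ => ?_
      by_cases hk : ℓ k = m <;> simp [hk, vecMul_apply, Finset.sum_mul]
    · rw [Finset.sum_filter]
      refine Finset.sum_congr rfl fun k _ => ?_
      by_cases hk : ℓ k = m <;> simp [hk, mulVec_apply, Finset.mul_sum, mul_assoc]
  rw [e1]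
  simp only [dotProduct, vecMul_apply, Finset.sum_mul, ← Finset.sum_neg_distrib]
  rw [Finset.sum_comm]
  refine Finset.sum_congr rfl fun k _ => Finset.sum_congr rfl fun i _ => ?_
  rw [exitRate, Matrix.of_apply]
  by_cases hi : ℓ i < m
  · simp [hp0 i hi]
  by_cases hk : ℓ k = ℓ i
  · have : ¬ (ℓ i = m ∧ ℓ k = m + 1) := by omega
    rw [if_neg this]
    simp [hk]
  by_cases hk' : ℓ k = ℓ i + 1
  · by_cases him : ℓ i = m
    · simp [him, hk']
    · have : ℓ k ≠ m := by omega
      simp [him, this]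
  · simp [h.step i k hk hk']

/-- Integrating over the time of the jump from level `m` to level `m + 1`. -/
theorem lintegral_exitRate (h : IsSequentialGenerator Λ ℓ n) {m : ℕ} {v : E → ℝ}
    (hv : ∀ i, ℓ i ≠ m → v i = 0) (hv0 : ∀ i, 0 ≤ v i) {j : E} (hj : ℓ j = m + 1) {s t d : ℝ}
    (hs : 0 ≤ s) (hst : s ≤ t) (htd : t ≤ d) :
    ∫⁻ r in Set.Ioc s t, ENNReal.ofReal
        ((((v ᵥ* transition Λ r) ᵥ* exitRate Λ ℓ m) ᵥ* transition Λ (d - r)) j) =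
      ENNReal.ofReal (∑ i with ℓ i = m, (v ᵥ* transition Λ s) i *
        ∑ k with ℓ k = m + 1, transition Λ (t - s) i k * transition Λ (d - t) k j) := by
  set w : E → ℝ := Pi.single j 1 with hw
  set f : ℝ → ℝ := fun r =>
    (((v ᵥ* transition Λ r) ᵥ* exitRate Λ ℓ m) ᵥ* transition Λ (d - r)) j with hf
  have hcont : Continuous f := by
    have h1 : Continuous fun r : ℝ =>
        ((v ᵥ* transition Λ r) ᵥ* exitRate Λ ℓ m) ᵥ* transition Λ (d - r) :=
      ((continuous_const.matrix_vecMul (continuous_transition Λ)).matrix_vecMul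
        continuous_const).matrix_vecMul ((continuous_transition Λ).comp (by fun_prop))
    exact (continuous_apply j).comp h1
  have hfw : ∀ r, f r =
      ((v ᵥ* transition Λ r) ᵥ* exitRate Λ ℓ m) ⬝ᵥ (transition Λ (d - r) *ᵥ w) := by
    intro r
    rw [Matrix.dotProduct_mulVec, hw, dotProduct_single_one]
  rw [← ofReal_integral_eq_lintegral_ofReal, ← intervalIntegral.integral_of_le hst]
  · have hderiv := fun r (_ : r ∈ Set.uIcc s t) => (h.hasDerivAt_level hv w d r).neg
    rw [intervalIntegral.integral_eq_sub_of_hasDerivAt (f' := f)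
      (fun r hr => (hderiv r hr).congr_deriv (by rw [neg_neg, hfw]))
      (hcont.intervalIntegrable _ _)]
    congr 1
    have hQ : ∀ (r : ℝ) (k : E), (transition Λ r *ᵥ w) k = transition Λ r k j := by
      intro r k
      rw [hw, Matrix.mulVec_single_one, Matrix.col_apply]
    -- The two endpoint values are compared at the intermediate time t: being at level m at time t
    -- forces level m at time s (`e1`), and a passage from level m to j is at level m or m + 1 at
    -- time t (`e2`). The terms with level m at time t cancel in the difference.
    have e1 : ∀ k, ℓ k = m → (v ᵥ* transition Λ t) k =
        ∑ i with ℓ i = m, (v ᵥ* transition Λ s) i * transition Λ (t - s) i k := by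
      intro k hk
      have : v ᵥ* transition Λ t = (v ᵥ* transition Λ s) ᵥ* transition Λ (t - s) := by
        rw [Matrix.vecMul_vecMul, ← transition_add, add_sub_cancel]
      rw [this, vecMul_apply]
      refine (Finset.sum_subset (Finset.subset_univ _) fun i _ hi => ?_).symm
      have hi : ℓ i ≠ m := by simpa using hi
      rcases lt_or_gt_of_ne hi with hi | hi
      · rw [h.vecMul_transition_eq_zero hv s hi, zero_mul]
      · rw [h.transition_eq_zero (t - s) (show ℓ k < ℓ i by omega), mul_zero]
    have e2 : ∀ i, ℓ i = m → transition Λ (d - s) i j =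
        ∑ k with ℓ k = m, transition Λ (t - s) i k * transition Λ (d - t) k j +
        ∑ k with ℓ k = m + 1, transition Λ (t - s) i k * transition Λ (d - t) k j := by
      intro i hi
      rw [show d - s = (t - s) + (d - t) by ring, transition_add, Matrix.mul_apply,
        ← Finset.sum_union]
      · refine (Finset.sum_subset (Finset.subset_univ _) fun k _ hk => ?_).symm
        have hk : ¬ (ℓ k = m ∨ ℓ k = m + 1) := by simpa using hk
        rcases lt_or_ge (ℓ k) m with hk' | hk'
        · rw [h.transition_eq_zero (t - s) (show ℓ k < ℓ i by omega), zero_mul]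
        · rw [h.transition_eq_zero (d - t) (show ℓ j < ℓ k by omega), mul_zero]
      · refine Finset.disjoint_left.2 fun k h1 h2 => ?_
        simp at h1 h2
        omega
    simp only [hQ, Pi.neg_apply, sub_neg_eq_add]
    have e3 : ∑ k with ℓ k = m, (v ᵥ* transition Λ t) k * transition Λ (d - t) k j =
        ∑ i with ℓ i = m, (v ᵥ* transition Λ s) i *
          ∑ k with ℓ k = m, transition Λ (t - s) i k * transition Λ (d - t) k j := by
      rw [Finset.sum_congr rfl fun k hk => by rw [e1 k (by simpa using hk), Finset.sum_mul],
        Finset.sum_comm]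
      simp only [Finset.mul_sum, mul_assoc]
    rw [e3, neg_add_eq_sub, ← Finset.sum_sub_distrib]
    refine Finset.sum_congr rfl fun i hi => ?_
    rw [e2 i (by simpa using hi)]
    ring
  · exact hcont.continuousOn.integrableOn_Icc.mono_set Set.Ioc_subset_Icc_self
  · refine (ae_restrict_iff' measurableSet_Ioc).2 (.of_forall fun r hr => ?_)
    exact vecMul_nonneg (vecMul_nonneg (vecMul_nonneg hv0
      (h.transition_nonneg (hs.trans hr.1.le))) (h.exitRate_nonneg ℓ m))
      (h.transition_nonneg (sub_nonneg.2 (hr.2.trans htd))) j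

/-- Induction on the number of sojourns, integrating out the last one by `lintegral_exitRate`. What
is left is the law at level m at time a m, so the induction hypothesis is needed at the later time c
= a m; this is why the free terminal time c is carried along. -/
theorem setLIntegral_sumBox_vecMul (h : IsSequentialGenerator Λ ℓ n) (hπ : ∀ i, ℓ i ≠ 0 → π i = 0)
    (hπ0 : ∀ i, 0 ≤ π i) (hb : b 0 = 0) (hba : ∀ k, b k ≤ a k) (hab : ∀ k, a k ≤ b (k + 1))
    (m : ℕ) {c : ℝ} (hc : b m ≤ c) {j : E} (hj : ℓ j = m) :
    ∫⁻ y in sumBox a b m, ENNReal.ofReal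
        ((pathRow Λ ℓ π m y ᵥ* transition Λ (c - ∑ l, y l)) j) =
      ENNReal.ofReal ((gridRow Λ ℓ π a b m ᵥ* transition Λ (c - b m)) j) := by
  have hmeas : ∀ (m : ℕ) (c : ℝ) (j : E), Measurable fun y : Fin m → ℝ =>
      ENNReal.ofReal ((pathRow Λ ℓ π m y ᵥ* transition Λ (c - ∑ l, y l)) j) := by
    intro m c j
    have h1 : Continuous fun y : Fin m → ℝ =>
        pathRow Λ ℓ π m y ᵥ* transition Λ (c - ∑ l, y l) :=
      (continuous_pathRow Λ ℓ π m).matrix_vecMul ((continuous_transition Λ).comp (by fun_prop))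
    exact ((continuous_apply j).comp h1).measurable.ennreal_ofReal
  induction m generalizing c j with
  | zero =>
    have : sumBox a b 0 = Set.univ := Set.eq_univ_of_forall fun y k => k.elim0
    rw [this, Measure.restrict_univ, volume_pi, Measure.pi_of_empty, lintegral_dirac]
    simp [pathRow, gridRow, hb]
  | succ m ih =>
    rw [setLIntegral_snoc (hmeas (m + 1) c j) (measurableSet_sumBox a b (m + 1))
      (measurableSet_sumBox a b m) (fun y => measurableSet_Ioc) fun y t => snoc_mem_sumBox]
    have hbm : 0 ≤ b m := by
      have := monotone_nat_of_le_succ fun k => (hba k).trans (hab k)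
      exact hb ▸ this (Nat.zero_le m)
    -- The future after time a m: from i, be at level m + 1 at time b (m + 1) and at j at time c. It
    -- does not depend on the earlier sojourns y.
    set C : E → ℝ := fun i => ∑ k with ℓ k = m + 1,
      transition Λ (b (m + 1) - a m) i k * transition Λ (c - b (m + 1)) k j with hC
    have hC0 : ∀ i, 0 ≤ C i := fun i => Finset.sum_nonneg fun k _ => mul_nonneg
      (h.transition_nonneg (sub_nonneg.2 (hab m)) i k) (h.transition_nonneg (sub_nonneg.2 hc) k j)
    have hin : ∀ y ∈ sumBox a b m,
        ∫⁻ t in Set.Ioc (a m - ∑ l, y l) (b (m + 1) - ∑ l, y l), ENNReal.ofReal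
          ((pathRow Λ ℓ π (m + 1) (Fin.snoc y t) ᵥ*
            transition Λ (c - ∑ l, (Fin.snoc y t : Fin (m + 1) → ℝ) l)) j) =
        ∑ i with ℓ i = m, ENNReal.ofReal
          ((pathRow Λ ℓ π m y ᵥ* transition Λ (a m - ∑ l, y l)) i) * ENNReal.ofReal (C i) := by
      intro y hy
      have hsum := sum_le_of_mem_sumBox hb hy
      have hs : 0 ≤ a m - ∑ l, y l := by linarith [hba m]
      have hv0 : ∀ i, 0 ≤ pathRow Λ ℓ π m y i :=
        h.pathRow_nonneg hπ0 (nonneg_of_mem_sumBox hb hba hy)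
      have := h.lintegral_exitRate (fun i hi => pathRow_eq_zero hπ y hi) hv0 hj hs
        (sub_le_sub_right (hab m) _) (sub_le_sub_right hc _)
      simp only [pathRow_snoc, Fin.sum_univ_castSucc, Fin.snoc_castSucc, Fin.snoc_last,
        ← sub_sub]
      rw [this, ENNReal.ofReal_sum_of_nonneg]
      · refine Finset.sum_congr rfl fun i _ => ?_
        rw [← ENNReal.ofReal_mul (vecMul_nonneg hv0 (h.transition_nonneg hs) i)]
        simp only [hC, sub_sub_sub_cancel_right]
      · exact fun i _ => mul_nonneg (vecMul_nonneg hv0 (h.transition_nonneg hs) i)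
          (Finset.sum_nonneg fun k _ => mul_nonneg (h.transition_nonneg (by linarith [hab m]) i k)
            (h.transition_nonneg (by linarith) k j))
    rw [setLIntegral_congr_fun (measurableSet_sumBox a b m) hin, lintegral_finsetSum]
    · have hg : ∀ i, 0 ≤ (gridRow Λ ℓ π a b m ᵥ* transition Λ (a m - b m)) i :=
        vecMul_nonneg (h.gridRow_nonneg hπ0 hba hab m) (h.transition_nonneg (sub_nonneg.2 (hba m)))
      have : ∀ i ∈ Finset.univ.filter (fun i => ℓ i = m),
          ∫⁻ y in sumBox a b m, ENNReal.ofReal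
            ((pathRow Λ ℓ π m y ᵥ* transition Λ (a m - ∑ l, y l)) i) * ENNReal.ofReal (C i) =
          ENNReal.ofReal ((gridRow Λ ℓ π a b m ᵥ* transition Λ (a m - b m)) i * C i) := by
        intro i hi
        rw [lintegral_mul_const _ (hmeas m (a m) i), ih (hba m) (by simpa using hi),
          ENNReal.ofReal_mul (hg i)]
      rw [Finset.sum_congr rfl this,
        ← ENNReal.ofReal_sum_of_nonneg fun i _ => mul_nonneg (hg i) (hC0 i)]
      congr 1
      rw [vecMul_apply]
      simp only [gridRow, hC, ite_mul, zero_mul, Finset.mul_sum]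
      rw [Finset.sum_comm, Finset.sum_filter]
      simp only [Finset.sum_mul, mul_assoc]
    · exact fun i _ => (hmeas m (a m) i).mul_const _

/-- The mass of the path density over a box of partial sums. -/
theorem setLIntegral_sumBox (h : IsSequentialGenerator Λ ℓ n) (hπ : ∀ i, ℓ i ≠ 0 → π i = 0)
    (hπ0 : ∀ i, 0 ≤ π i) (hb : b 0 = 0) (hba : ∀ k, b k ≤ a k) (hab : ∀ k, a k ≤ b (k + 1)) :
    ∫⁻ y in sumBox a b n, ENNReal.ofReal (∑ j, pathRow Λ ℓ π n y j) =
      ENNReal.ofReal (∑ j, gridRow Λ ℓ π a b n j) := by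
  -- Level n is the top level, so mass on it stays there under the semigroup. This inserts the
  -- transition factor demanded by `setLIntegral_sumBox_vecMul`.
  have hsum : ∀ (v : E → ℝ), (∀ i, ℓ i ≠ n → v i = 0) → ∀ t,
      ∑ j, v j = ∑ j with ℓ j = n, (v ᵥ* transition Λ t) j := by
    intro v hv t
    have h1 : ∑ j, (v ᵥ* transition Λ t) j = ∑ j, v j := by
      simp only [vecMul_apply]
      rw [Finset.sum_comm]
      simp [← Finset.mul_sum, h.sum_transition]
    rw [← h1]
    refine (Finset.sum_subset (Finset.subset_univ _) fun j _ hj => ?_).symm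
    have := h.level_le j
    exact h.vecMul_transition_eq_zero hv t (by simp at hj; omega)
  have hg : ∀ i, ℓ i ≠ n → gridRow Λ ℓ π a b n i = 0 := by
    intro i hi
    cases n with
    | zero => exact hπ i hi
    | succ m => simp [gridRow, hi]
  have hin : ∀ y ∈ sumBox a b n, ENNReal.ofReal (∑ j, pathRow Λ ℓ π n y j) =
      ∑ j with ℓ j = n, ENNReal.ofReal
        ((pathRow Λ ℓ π n y ᵥ* transition Λ (b n - ∑ l, y l)) j) := by
    intro y hy
    rw [hsum _ (fun i hi => pathRow_eq_zero hπ y hi) (b n - ∑ l, y l),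
      ENNReal.ofReal_sum_of_nonneg]
    exact fun j _ => vecMul_nonneg (h.pathRow_nonneg hπ0 (nonneg_of_mem_sumBox hb hba hy))
      (h.transition_nonneg (sub_nonneg.2 (sum_le_of_mem_sumBox hb hy))) j
  rw [setLIntegral_congr_fun (measurableSet_sumBox a b n) hin, lintegral_finsetSum]
  · rw [hsum _ hg (b n - b n), ENNReal.ofReal_sum_of_nonneg]
    · refine Finset.sum_congr rfl fun j hj => ?_
      exact h.setLIntegral_sumBox_vecMul hπ hπ0 hb hba hab n le_rfl (by simpa using hj)
    · exact fun j _ => vecMul_nonneg (h.gridRow_nonneg hπ0 hba hab n)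
        (h.transition_nonneg (sub_self (b n)).ge) j
  · intro j _
    have h1 : Continuous fun y : Fin n → ℝ =>
        pathRow Λ ℓ π n y ᵥ* transition Λ (b n - ∑ l, y l) :=
      (continuous_pathRow Λ ℓ π n).matrix_vecMul ((continuous_transition Λ).comp (by fun_prop))
    exact ((continuous_apply j).comp h1).measurable.ennreal_ofReal

/-- The path density has the total mass of the initial vector. -/
theorem setLIntegral_nonneg_pathRow (h : IsSequentialGenerator Λ ℓ n)
    (hπ : ∀ i, ℓ i ≠ 0 → π i = 0) (hπ0 : ∀ i, 0 ≤ π i) {m : ℕ} (hm : m ≤ n) :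
    ∫⁻ y in {y : Fin m → ℝ | ∀ k, 0 ≤ y k}, ENNReal.ofReal (∑ j, pathRow Λ ℓ π m y j) =
      ENNReal.ofReal (∑ j, π j) := by
  have hset : ∀ m : ℕ, MeasurableSet {y : Fin m → ℝ | ∀ k, 0 ≤ y k} := fun m => by
    have : {y : Fin m → ℝ | ∀ k, 0 ≤ y k} = ⋂ k, {y | 0 ≤ y k} := by ext; simp
    rw [this]
    exact MeasurableSet.iInter fun k => measurableSet_le measurable_const (measurable_pi_apply k)
  induction m with
  | zero =>
    have : {y : Fin 0 → ℝ | ∀ k, 0 ≤ y k} = Set.univ := Set.eq_univ_of_forall fun y k => k.elim0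
    rw [this, Measure.restrict_univ, volume_pi, Measure.pi_of_empty, lintegral_dirac]
    simp [pathRow]
  | succ m ih =>
    have hmeas : Measurable fun y : Fin (m + 1) → ℝ =>
        ENNReal.ofReal (∑ j, pathRow Λ ℓ π (m + 1) y j) :=
      (continuous_finsetSum _ fun j _ =>
        (continuous_apply j).comp (continuous_pathRow Λ ℓ π (m + 1))).measurable.ennreal_ofReal
    rw [setLIntegral_snoc hmeas (hset (m + 1)) (hset m)
      (v := fun _ => Set.Ici 0) (fun _ => measurableSet_Ici)
      fun y t => by simp [Fin.forall_fin_succ'], ← ih (by omega)]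
    refine setLIntegral_congr_fun (hset m) fun y hy => ?_
    set v := pathRow Λ ℓ π m y with hvdef
    have hv : ∀ i, ℓ i ≠ m → v i = 0 := fun i hi => pathRow_eq_zero hπ y hi
    have hv0 : ∀ i, 0 ≤ v i := h.pathRow_nonneg hπ0 hy
    simp only [pathRow_snoc, ← hvdef]
    set g : ℝ → ℝ := fun t => ∑ j, ((v ᵥ* transition Λ t) ᵥ* exitRate Λ ℓ m) j with hg
    set F : ℝ → ℝ := fun t => ∑ k with ℓ k = m, (v ᵥ* transition Λ t) k with hF
    -- With w = 1 the factor after the jump drops out, and the exit flux is exactly the rate at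
    -- which the mass of level m decreases.
    have hderiv : ∀ t, HasDerivAt (fun t => -F t) (g t) t := by
      intro t
      have := (h.hasDerivAt_level hv 1 0 t).neg
      simp only [h.transition_mulVec_one, Pi.one_apply, mul_one, neg_neg, dotProduct_one] at this
      exact this
    have hlim : Tendsto (fun t => -F t) atTop (𝓝 0) := by
      rw [← neg_zero]
      refine Tendsto.neg ?_
      rw [← Finset.sum_const_zero (s := Finset.univ.filter fun k => ℓ k = m)]
      refine tendsto_finsetSum _ fun k hk => ?_
      have hk : ℓ k < n := by simp at hk; omega
      simp only [vecMul_apply]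
      have := tendsto_finsetSum Finset.univ fun i _ => (h.tendsto_transition i hk).const_mul (v i)
      simpa using this
    have hg0 : ∀ t ∈ Set.Ioi (0 : ℝ), 0 ≤ g t := fun t ht => Finset.sum_nonneg fun j _ =>
      vecMul_nonneg (vecMul_nonneg hv0 (h.transition_nonneg (le_of_lt ht)))
        (h.exitRate_nonneg ℓ m) j
    rw [setLIntegral_congr Ioi_ae_eq_Ici.symm, ← ofReal_integral_eq_lintegral_ofReal,
      integral_Ioi_of_hasDerivAt_of_nonneg' (fun t _ => hderiv t) hg0 hlim]
    · congr 1
      simp only [hF, transition_zero, Matrix.vecMul_one, zero_sub, neg_neg]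
      exact Finset.sum_subset (Finset.subset_univ _) fun k _ hk => hv k (by simpa using hk)
    · exact integrableOn_Ioi_deriv_of_nonneg' (fun t _ => hderiv t) hg0 hlim
    · exact (ae_restrict_iff' measurableSet_Ioi).2 (.of_forall hg0)

end IsSequentialGenerator

end PathDensity

/-- The times `b 0, a 0, b 1, a 1, …`. -/
def interleave (a b : ℕ → ℝ≥0) (r : ℕ) : ℝ≥0 := if Even r then b (r / 2) else a (r / 2)

theorem interleave_two_mul (a b : ℕ → ℝ≥0) (m : ℕ) : interleave a b (2 * m) = b m := by
  simp [interleave]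

theorem interleave_two_mul_add_one (a b : ℕ → ℝ≥0) (m : ℕ) :
    interleave a b (2 * m + 1) = a m := by
  have : (2 * m + 1) / 2 = m := by omega
  simp [interleave, this]

theorem monotone_interleave {a b : ℕ → ℝ≥0} (hba : ∀ k, b k ≤ a k) (hab : ∀ k, a k ≤ b (k + 1)) :
    Monotone (interleave a b) := by
  refine monotone_nat_of_le_succ fun r => ?_
  obtain ⟨m, rfl | rfl⟩ := Nat.even_or_odd' r
  · rw [interleave_two_mul, interleave_two_mul_add_one]
    exact hba m
  · rw [interleave_two_mul_add_one, show 2 * m + 1 + 1 = 2 * (m + 1) by ring, interleave_two_mul]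
    exact hab m

theorem exists_nnratCast_btwn {u v : ℝ≥0} (huv : u < v) :
    ∃ q : ℚ≥0, u < (q : ℝ≥0) ∧ (q : ℝ≥0) < v := by
  obtain ⟨q, hq, hq'⟩ := (NNReal.lt_iff_exists_rat_btwn u v).1 huv
  lift q to ℚ≥0 using hq
  have : Real.toNNReal ((q : ℚ) : ℝ) = (q : ℝ≥0) := by
    ext
    rw [Real.coe_toNNReal _ (by positivity)]
    have h : ((q : ℚ) : ℝ) = (q : ℝ) := by norm_cast
    exact h
  exact ⟨q, by rwa [this] at hq'⟩

/-! ### Paths of the process: grid events, monotone levels, exit times -/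

section Paths

variable {E : Type*} [Fintype E] [DecidableEq E] {Ω : Type*} [MeasurableSpace Ω]
  {P : Measure Ω} {Λ : Matrix E E ℝ} {ℓ : E → ℕ} {n : ℕ} {π : E → ℝ}
  {X : ℝ≥0 → Ω → E}

namespace IsMarkovJumpProcess

theorem measurableSet_mem (hX : IsMarkovJumpProcess P Λ π X) (t : ℝ≥0) (B : Set E) :
    MeasurableSet {ω | X t ω ∈ B} := by
  have : {ω | X t ω ∈ B} = ⋃ i ∈ B, {ω | X t ω = i} := by ext; simp
  rw [this]
  exact MeasurableSet.biUnion (Set.to_countable B) fun i _ => hX.measurable t i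

variable [IsProbabilityMeasure P]

/-- The Markov property for a past event of the form `X (τ r) ∈ B r` for all `r ≤ m`. -/
theorem markov_of_mem (hX : IsMarkovJumpProcess P Λ π X) {τ : ℕ → ℝ≥0} (hτ : Monotone τ)
    (B : ℕ → Set E) (m : ℕ) (u : ℝ≥0) (i j : E) :
    P.real {ω | ((∀ r ≤ m, X (τ r) ω ∈ B r) ∧ X (τ m) ω = i) ∧ X (τ m + u) ω = j} =
      P.real {ω | (∀ r ≤ m, X (τ r) ω ∈ B r) ∧ X (τ m) ω = i} * transition Λ u i j := by
  classical
  set s : Finset (Fin (m + 1) → E) := Finset.univ.filter fun x =>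
    (∀ r : Fin (m + 1), x r ∈ B r) ∧ x (Fin.last m) = i with hs
  have hdisj : ∀ G : Set Ω, (s : Set (Fin (m + 1) → E)).PairwiseDisjoint
      fun x => {ω | ∀ r : Fin (m + 1), X (τ r) ω = x r} ∩ G := by
    intro G x _ y _ hxy
    refine Set.disjoint_left.2 fun ω h1 h2 => hxy (funext fun r => ?_)
    rw [← h1.1 r, h2.1 r]
  have hx : ∀ x : Fin (m + 1) → E, MeasurableSet {ω | ∀ r : Fin (m + 1), X (τ r) ω = x r} := by
    intro x
    have : {ω | ∀ r : Fin (m + 1), X (τ r) ω = x r} = ⋂ r : Fin (m + 1), {ω | X (τ r) ω = x r} := by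
      ext; simp
    rw [this]
    exact MeasurableSet.iInter fun r => hX.measurable _ _
  have hunion : {ω | (∀ r ≤ m, X (τ r) ω ∈ B r) ∧ X (τ m) ω = i} =
      ⋃ x ∈ s, {ω | ∀ r : Fin (m + 1), X (τ r) ω = x r} := by
    ext ω
    simp only [Set.mem_ofPred_eq, Set.mem_iUnion, hs, Finset.mem_filter, Finset.mem_univ, true_and,
      exists_prop]
    constructor
    · rintro ⟨h1, h2⟩
      exact ⟨fun r => X (τ r) ω, ⟨fun r => h1 r (by omega), by simpa using h2⟩, fun _ => rfl⟩
    · rintro ⟨x, ⟨h1, h2⟩, h3⟩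
      refine ⟨fun r hr => ?_, ?_⟩
      · have := h3 ⟨r, by omega⟩
        simp only at this
        rw [this]
        exact h1 ⟨r, by omega⟩
      · rw [← h2, ← h3]
        simp
  have hunion' : {ω | ((∀ r ≤ m, X (τ r) ω ∈ B r) ∧ X (τ m) ω = i) ∧ X (τ m + u) ω = j} =
      ⋃ x ∈ s, {ω | ∀ r : Fin (m + 1), X (τ r) ω = x r} ∩ {ω | X (τ m + u) ω = j} := by
    rw [← Set.iUnion₂_inter, ← hunion]
    rfl
  rw [hunion', measureReal_biUnion_finset (hdisj _) fun x _ => (hx x).inter (hX.measurable _ _),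
    hunion, measureReal_biUnion_finset (by simpa using hdisj Set.univ) fun x _ => hx x,
    Finset.sum_mul]
  refine Finset.sum_congr rfl fun x hxs => ?_
  have hlast : x (Fin.last m) = i := by simpa using (Finset.mem_filter.1 hxs).2.2
  have := hX.markov m (fun r => τ r) (hτ.comp Fin.val_strictMono.monotone) x u j
  rw [hlast] at this
  exact this

theorem real_succ (hX : IsMarkovJumpProcess P Λ π X) {τ : ℕ → ℝ≥0} (hτ : Monotone τ)
    (B : ℕ → Set E) (m : ℕ) {j : E} (hj : j ∈ B (m + 1)) :
    P.real {ω | (∀ r ≤ m + 1, X (τ r) ω ∈ B r) ∧ X (τ (m + 1)) ω = j} =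
      ∑ i, P.real {ω | (∀ r ≤ m, X (τ r) ω ∈ B r) ∧ X (τ m) ω = i} *
        transition Λ (τ (m + 1) - τ m) i j := by
  have hmeas : MeasurableSet {ω | ∀ r ≤ m, X (τ r) ω ∈ B r} := by
    have : {ω | ∀ r ≤ m, X (τ r) ω ∈ B r} = ⋂ r ∈ Set.Iic m, {ω | X (τ r) ω ∈ B r} := by ext; simp
    rw [this]
    exact MeasurableSet.biInter (Set.to_countable _) fun r _ => hX.measurableSet_mem _ _
  have hadd : τ m + (τ (m + 1) - τ m) = τ (m + 1) := add_tsub_cancel_of_le (hτ m.le_succ)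
  have hunion : {ω | (∀ r ≤ m + 1, X (τ r) ω ∈ B r) ∧ X (τ (m + 1)) ω = j} =
      ⋃ i ∈ (Finset.univ : Finset E),
        {ω | ((∀ r ≤ m, X (τ r) ω ∈ B r) ∧ X (τ m) ω = i) ∧ X (τ m + (τ (m + 1) - τ m)) ω = j} := by
    ext ω
    simp only [hadd, Set.mem_ofPred_eq, Set.mem_iUnion, Finset.mem_univ, exists_prop, true_and]
    constructor
    · rintro ⟨h1, h2⟩
      exact ⟨_, ⟨fun r hr => h1 r (by omega), rfl⟩, h2⟩
    · rintro ⟨i, ⟨h1, -⟩, h2⟩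
      refine ⟨fun r hr => ?_, h2⟩
      rcases Nat.le_succ_iff.1 hr with hr | rfl
      · exact h1 r hr
      · rwa [h2]
  rw [hunion, measureReal_biUnion_finset]
  · refine Finset.sum_congr rfl fun i _ => ?_
    rw [hX.markov_of_mem hτ B m _ i j, NNReal.coe_sub (hτ m.le_succ)]
  · intro i _ i' _ hii
    exact Set.disjoint_left.2 fun ω h1 h2 => hii (h1.1.2.symm.trans h2.1.2)
  · exact fun i _ => (hmeas.inter (hX.measurable _ _)).inter (hX.measurable _ _)

/-- Each step of the recursion is two uses of the Markov property, from b m to a m and from a m to b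
(m + 1). The times with indices 2m and 2m + 1 both carry level m, which the integer division r / 2
encodes. -/
theorem gridRow_eq (hX : IsMarkovJumpProcess P Λ π X) (hπ : ∀ i, ℓ i ≠ 0 → π i = 0)
    {a b : ℕ → ℝ≥0} (hb : b 0 = 0) (hba : ∀ k, b k ≤ a k) (hab : ∀ k, a k ≤ b (k + 1)) (m : ℕ)
    (j : E) :
    gridRow Λ ℓ π (fun k => a k) (fun k => b k) m j =
      P.real {ω | (∀ r ≤ 2 * m, X (interleave a b r) ω ∈ {i | ℓ i = r / 2}) ∧
        X (interleave a b (2 * m)) ω = j} := by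
  have hτ := monotone_interleave hba hab
  induction m generalizing j with
  | zero =>
    by_cases hj : ℓ j = 0
    · rw [gridRow, ← hX.initial j]
      congr 1
      ext ω
      simp only [interleave_two_mul, hb]
      simp only [Set.mem_ofPred_eq, nonpos_iff_eq_zero, mul_zero, forall_eq]
      constructor
      · rintro rfl
        simpa [interleave, hb] using hj
      · exact fun h => h.2
    · rw [gridRow, hπ j hj]
      symm
      convert measureReal_empty using 2
      ext ω
      simp only [Set.mem_ofPred_eq, nonpos_iff_eq_zero, mul_zero, forall_eq, Set.mem_empty_iff_false,
        iff_false]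
      rintro ⟨h1, h2⟩
      rw [h2] at h1
      exact hj h1
  | succ m ih =>
    simp only [gridRow]
    split_ifs with hj
    · have hj' : j ∈ {i | ℓ i = (2 * m + 1 + 1) / 2} := by
        simp only [Set.mem_ofPred_eq]; omega
      have h2 := hX.real_succ hτ (fun r => {i | ℓ i = r / 2}) (2 * m + 1) hj'
      rw [show 2 * (m + 1) = 2 * m + 1 + 1 by ring, h2, Finset.sum_filter]
      refine Finset.sum_congr rfl fun i _ => ?_
      split_ifs with hi
      · have hi' : i ∈ {i | ℓ i = (2 * m + 1) / 2} := by
          simp only [Set.mem_ofPred_eq]; omega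
        rw [hX.real_succ hτ (fun r => {i | ℓ i = r / 2}) (2 * m) hi', vecMul_apply]
        simp only [ih, interleave_two_mul, interleave_two_mul_add_one,
          show 2 * m + 1 + 1 = 2 * (m + 1) by ring]
      · symm
        convert zero_mul _ using 2
        convert measureReal_empty using 2
        ext ω
        simp only [Set.mem_ofPred_eq, Set.mem_empty_iff_false, iff_false]
        rintro ⟨h1, h2⟩
        have := h1 (2 * m + 1) le_rfl
        rw [h2] at this
        omega
    · symm
      convert measureReal_empty using 2
      ext ω
      simp only [Set.mem_ofPred_eq, Set.mem_empty_iff_false, iff_false]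
      rintro ⟨h1, h2⟩
      have := h1 (2 * (m + 1)) le_rfl
      rw [h2] at this
      omega

theorem sum_gridRow_eq (hX : IsMarkovJumpProcess P Λ π X) (hπ : ∀ i, ℓ i ≠ 0 → π i = 0)
    {a b : ℕ → ℝ≥0} (hb : b 0 = 0) (hba : ∀ k, b k ≤ a k) (hab : ∀ k, a k ≤ b (k + 1)) (m : ℕ) :
    ∑ j, gridRow Λ ℓ π (fun k => a k) (fun k => b k) m j =
      P.real {ω | ∀ r ≤ 2 * m, ℓ (X (interleave a b r) ω) = r / 2} := by
  simp only [hX.gridRow_eq hπ hb hba hab]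
  have hmeas : MeasurableSet
      {ω | ∀ r ≤ 2 * m, X (interleave a b r) ω ∈ {i | ℓ i = r / 2}} := by
    have : {ω | ∀ r ≤ 2 * m, X (interleave a b r) ω ∈ {i | ℓ i = r / 2}} =
        ⋂ r ∈ Set.Iic (2 * m), {ω | X (interleave a b r) ω ∈ {i | ℓ i = r / 2}} := by ext; simp
    rw [this]
    exact MeasurableSet.biInter (Set.to_countable _) fun r _ => hX.measurableSet_mem _ _
  rw [← measureReal_biUnion_finset]
  · congr 1
    ext ω
    simp
  · intro i _ i' _ hii
    exact Set.disjoint_left.2 fun ω h1 h2 => hii (h1.2.symm.trans h2.2)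
  · exact fun i _ => hmeas.inter (hX.measurable _ _)

/-- Almost surely, the level never decreases. -/
theorem ae_monotone_level (hX : IsMarkovJumpProcess P Λ π X) (h : IsSequentialGenerator Λ ℓ n) :
    ∀ᵐ ω ∂P, Monotone fun t => ℓ (X t ω) := by
  have hle : ∀ s t : ℝ≥0, s ≤ t → ∀ᵐ ω ∂P, ℓ (X s ω) ≤ ℓ (X t ω) := by
    intro s t hst
    have hij : ∀ i j : E, ∀ᵐ ω ∂P, ℓ j < ℓ i → ¬ (X s ω = i ∧ X t ω = j) := by
      intro i j
      by_cases hlt : ℓ j < ℓ i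
      · have h0 : P.real {ω | X s ω = i ∧ X t ω = j} = 0 := by
          have := hX.markov 0 (fun _ => s) (fun _ _ _ => le_rfl) (fun _ => i) (t - s) j
          simpa [add_tsub_cancel_of_le hst, h.transition_eq_zero _ hlt] using this
        rw [measureReal_eq_zero_iff] at h0
        filter_upwards [measure_eq_zero_iff_ae_notMem.1 h0] with ω hω _ using hω
      · exact .of_forall fun ω hc => absurd hc hlt
    filter_upwards [ae_all_iff.2 fun i => ae_all_iff.2 (hij i)] with ω hω
    by_contra! hc
    exact hω _ _ hc ⟨rfl, rfl⟩
  -- Countably many null sets suffice for rational times; right-continuity then moves s and t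
  -- slightly to the right onto rationals in the same order.
  have hq : ∀ᵐ ω ∂P, ∀ p q : ℚ≥0, (p : ℝ≥0) ≤ q → ℓ (X p ω) ≤ ℓ (X q ω) := by
    refine ae_all_iff.2 fun p => ae_all_iff.2 fun q => ?_
    by_cases hpq : (p : ℝ≥0) ≤ q
    · filter_upwards [hle p q hpq] with ω hω _ using hω
    · exact .of_forall fun ω hc => absurd hc hpq
  filter_upwards [hq, hX.right_continuous] with ω hω hrc s t hst
  rcases hst.eq_or_lt with rfl | hst
  · exact le_rfl
  obtain ⟨δ, hδ, hs⟩ := hrc s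
  obtain ⟨ε, hε, ht⟩ := hrc t
  obtain ⟨p, hp1, hp2⟩ :=
    exists_nnratCast_btwn (lt_min hst (lt_add_of_pos_right s hδ))
  obtain ⟨q, hq1, hq2⟩ := exists_nnratCast_btwn (lt_add_of_pos_right t hε)
  have := hω p q ((hp2.trans_le (min_le_left _ _)).trans hq1).le
  rwa [hs p hp1.le (hp2.trans_le (min_le_right _ _)), ht q hq1.le hq2] at this

end IsMarkovJumpProcess

/-- The total time that the path `x` spends at level `k`. -/
noncomputable def levelTime {E : Type*} (ℓ : E → ℕ) (x : ℝ≥0 → E) (k : ℕ) : ℝ≥0∞ :=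
  ∫⁻ s in Set.Ici (0 : ℝ), {i | ℓ i = k}.indicator (fun _ => (1 : ℝ≥0∞)) (x s.toNNReal)

theorem sum_levelTime {E : Type*} {ℓ : E → ℕ} {x : ℝ≥0 → E} (hx : Monotone fun t => ℓ (x t))
    (k : ℕ) : ∑ l ∈ Finset.range (k + 1), levelTime ℓ x l =
      volume {s : ℝ | 0 ≤ s ∧ ℓ (x s.toNNReal) ≤ k} := by
  have hmeas : Measurable fun s : ℝ => ℓ (x s.toNNReal) :=
    Monotone.measurable fun s t hst => hx (Real.toNNReal_le_toNNReal hst)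
  have hset : MeasurableSet {s : ℝ | ℓ (x s.toNNReal) ≤ k} := hmeas (measurableSet_Iic (a := k))
  have h1 : {s : ℝ | 0 ≤ s ∧ ℓ (x s.toNNReal) ≤ k} =
      {s : ℝ | ℓ (x s.toNNReal) ≤ k} ∩ Set.Ici 0 := by ext; simp [and_comm]
  unfold levelTime
  rw [← lintegral_finsetSum, h1, ← Measure.restrict_apply hset, ← lintegral_indicator_one hset]
  · refine lintegral_congr fun s => ?_
    simp only [Set.indicator_apply, Set.mem_ofPred_eq, Finset.sum_ite_eq, Finset.mem_range,
      Nat.lt_succ_iff, Pi.one_apply]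
  · intro l _
    have hl : MeasurableSet {s : ℝ | ℓ (x s.toNNReal) = l} := hmeas (measurableSet_singleton l)
    exact measurable_const.indicator hl

/-- The level exceeds `k` exactly from the time on that was spent at the levels `0, …, k`. -/
theorem lt_sum_levelTime_iff {E : Type*} {ℓ : E → ℕ} {x : ℝ≥0 → E}
    (hx : Monotone fun t => ℓ (x t))
    (hrc : ∀ t : ℝ≥0, ∃ ε : ℝ≥0, 0 < ε ∧ ∀ s, t ≤ s → s < t + ε → x s = x t) (k : ℕ) (t : ℝ≥0) :
    (t : ℝ≥0∞) < ∑ l ∈ Finset.range (k + 1), levelTime ℓ x l ↔ ℓ (x t) ≤ k := by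
  rw [sum_levelTime hx]
  constructor
  · intro hlt
    by_contra! hk
    refine absurd hlt (not_lt.2 ?_)
    calc volume {s : ℝ | 0 ≤ s ∧ ℓ (x s.toNNReal) ≤ k}
        ≤ volume (Set.Ico (0 : ℝ) t) := by
          refine measure_mono fun s hs => ⟨hs.1, ?_⟩
          by_contra! hts
          have : t ≤ s.toNNReal := NNReal.le_toNNReal_of_coe_le hts
          have : ℓ (x t) ≤ ℓ (x s.toNNReal) := hx this
          have := hs.2
          omega
      _ = t := by simp
  · intro hk
    obtain ⟨ε, hε, hs⟩ := hrc t
    calc (t : ℝ≥0∞) < (t + ε : ℝ≥0) := by exact_mod_cast lt_add_of_pos_right t hε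
      _ = volume (Set.Ico (0 : ℝ) (t + ε : ℝ≥0)) := by
        rw [Real.volume_Ico, sub_zero, ENNReal.ofReal_coe_nnreal]
      _ ≤ volume {s : ℝ | 0 ≤ s ∧ ℓ (x s.toNNReal) ≤ k} := by
        refine measure_mono fun s hs' => ⟨hs'.1, ?_⟩
        have hs1 : s.toNNReal < t + ε := by
          rw [← NNReal.coe_lt_coe, Real.coe_toNNReal _ hs'.1]
          exact hs'.2
        rcases le_total t s.toNNReal with hts | hts
        · rwa [hs _ hts hs1]
        · exact (hx hts).trans hk

end Paths

theorem toReal_sum_levelTime_mem_Ioc_iff {E : Type*} {ℓ : E → ℕ} {x : ℝ≥0 → E}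
    (hx : Monotone fun t => ℓ (x t))
    (hrc : ∀ t : ℝ≥0, ∃ ε : ℝ≥0, 0 < ε ∧ ∀ s, t ≤ s → s < t + ε → x s = x t) (k : ℕ)
    (s t : ℝ≥0) :
    (∑ l ∈ Finset.range (k + 1), levelTime ℓ x l).toReal ∈ Set.Ioc (s : ℝ) t ↔
      ℓ (x s) ≤ k ∧ k < ℓ (x t) := by
  rw [← not_le (a := ℓ (x t)), ← lt_sum_levelTime_iff hx hrc, ← lt_sum_levelTime_iff hx hrc]
  generalize ∑ l ∈ Finset.range (k + 1), levelTime ℓ x l = T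
  induction T with
  -- An infinite exit time has `toReal` equal to 0, which lies in no interval (s, t] with s ≥ 0; the
  -- other side fails as well, since an infinite time is not at most t.
  | top => simp
  | coe T => simp

/-! ### Partial sums and ordered boxes -/

section PartialSums

/-- The vector of partial sums. -/
def partialSums {n : ℕ} (y : Fin n → ℝ) (k : Fin n) : ℝ := ∑ l ∈ Finset.Iic k, y l

theorem measurable_partialSums {n : ℕ} : Measurable (partialSums (n := n)) :=
  measurable_pi_lambda _ fun _ => Finset.measurable_sum _ fun l _ => measurable_pi_apply l

theorem partialSums_succ {n : ℕ} (y : Fin (n + 1) → ℝ) (k : Fin n) :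
    partialSums y k.succ = partialSums y k.castSucc + y k.succ := by
  have : Finset.Iic k.succ = insert k.succ (Finset.Iic k.castSucc) := by
    ext i
    simp only [Finset.mem_Iic, Finset.mem_insert, Fin.le_def, Fin.ext_iff, Fin.val_succ,
      Fin.val_castSucc]
    omega
  rw [partialSums, this, Finset.sum_insert (by simp), add_comm]
  rfl

theorem partialSums_zero {n : ℕ} (y : Fin (n + 1) → ℝ) : partialSums y 0 = y 0 := by
  have : Finset.Iic (0 : Fin (n + 1)) = {0} := by ext; simp
  rw [partialSums, this, Finset.sum_singleton]

/-- The vector of increments. -/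
def increments {n : ℕ} (t : Fin (n + 1) → ℝ) : Fin (n + 1) → ℝ :=
  Fin.cons (t 0) fun k => t k.succ - t k.castSucc

theorem increments_partialSums {n : ℕ} (y : Fin (n + 1) → ℝ) :
    increments (partialSums y) = y := by
  ext k
  refine Fin.cases ?_ (fun k => ?_) k
  · simp [increments, partialSums_zero]
  · simp [increments, partialSums_succ]

theorem measurable_increments {n : ℕ} : Measurable (increments (n := n)) := by
  refine measurable_pi_lambda _ fun k => ?_
  refine Fin.cases ?_ (fun k => ?_) k
  · exact measurable_pi_apply 0
  · exact (measurable_pi_apply k.succ).sub (measurable_pi_apply k.castSucc)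

/-- The points `0, q 0, q 1, …` (constant after the last one). -/
def gridPoint {n : ℕ} (q : Fin (n + 1) → ℚ≥0) : ℕ → ℝ≥0
  | 0 => 0
  | k + 1 => q ⟨min k n, by omega⟩

theorem monotone_gridPoint {n : ℕ} {q : Fin (n + 1) → ℚ≥0} (hq : Monotone q) :
    Monotone (gridPoint q) := by
  refine monotone_nat_of_le_succ fun k => ?_
  cases k with
  | zero => exact zero_le
  | succ k =>
    have : q ⟨min k n, by omega⟩ ≤ q ⟨min (k + 1) n, by omega⟩ :=
      hq (Fin.mk_le_mk.2 (min_le_min_right n k.le_succ))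
    simpa only [gridPoint] using NNRat.cast_mono this

/-- Points with strictly increasing positive coordinates lie in a box with ordered rational
sides. -/
theorem exists_mem_pi_Ioc_gridPoint {n : ℕ} {y : Fin (n + 1) → ℝ} (hy : ∀ k, 0 < y k) :
    ∃ q : Fin (n + 1) → ℚ≥0, Monotone q ∧ partialSums y ∈
      Set.pi Set.univ fun k : Fin (n + 1) =>
        Set.Ioc (gridPoint q k : ℝ) (gridPoint q (k + 1)) := by
  have hpos : ∀ k, 0 < partialSums y k := fun k =>
    Finset.sum_pos (fun l _ => hy l) ⟨k, Finset.mem_Iic.2 le_rfl⟩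
  -- One rational is placed strictly between consecutive partial sums, and one beyond the last.
  have hex : ∀ k : Fin (n + 1), ∃ q : ℚ≥0, partialSums y k < (q : ℝ≥0) ∧
      ∀ i : Fin n, k = i.castSucc → ((q : ℝ≥0) : ℝ) < partialSums y i.succ := by
    intro k
    obtain ⟨v, hv, hv'⟩ : ∃ v : ℝ, partialSums y k < v ∧
        ∀ i : Fin n, k = i.castSucc → v ≤ partialSums y i.succ := by
      refine Fin.lastCases ⟨_, lt_add_one _, fun i hi => ?_⟩ (fun i => ?_) k
      · exact absurd hi (Fin.castSucc_lt_last i).ne'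
      · refine ⟨partialSums y i.succ, ?_, fun j hj => ?_⟩
        · rw [partialSums_succ]
          linarith [hy i.succ]
        · rw [Fin.castSucc_injective _ hj]
    obtain ⟨q, hq1, hq2⟩ := exists_nnratCast_btwn
      (show (⟨partialSums y k, (hpos k).le⟩ : ℝ≥0) < ⟨v, ((hpos k).trans hv).le⟩ from hv)
    exact ⟨q, hq1, fun i hi => lt_of_lt_of_le (b := v) hq2 (hv' i hi)⟩
  choose q hq hq' using hex
  refine ⟨q, ?_, fun k _ => ⟨?_, ?_⟩⟩
  · refine Fin.monotone_iff_le_succ.2 fun i => ?_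
    have : ((q i.castSucc : ℝ≥0) : ℝ) < (q i.succ : ℝ≥0) :=
      (hq' i.castSucc i rfl).trans (hq i.succ)
    exact (NNRat.cast_lt.1 (NNReal.coe_lt_coe.1 this)).le
  · refine Fin.cases ?_ (fun i => ?_) k
    · simpa [gridPoint] using hpos 0
    · have h1 : (⟨min (i : ℕ) n, by omega⟩ : Fin (n + 1)) = i.castSucc := by
        ext
        simp [i.isLt.le]
      simp only [Fin.val_succ, gridPoint, h1]
      exact hq' i.castSucc i rfl
  · have h1 : (⟨min (k : ℕ) n, by omega⟩ : Fin (n + 1)) = k := by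
      ext
      simp [Nat.lt_succ_iff.1 k.isLt]
    simp only [gridPoint, h1]
    exact (hq k).le

/-- Finite measures that agree on all boxes with ordered nonnegative sides agree on the set of
partial sums of positive vectors. -/
theorem restrict_iUnion_eq_of_pi_Ioc {n : ℕ} {μ ν : Measure (Fin (n + 1) → ℝ)}
    [IsFiniteMeasure μ] [IsFiniteMeasure ν]
    (h : ∀ a b : ℕ → ℝ≥0, b 0 = 0 → (∀ k, b k ≤ a k) → (∀ k, a k ≤ b (k + 1)) →
      μ (Set.pi Set.univ fun k : Fin (n + 1) => Set.Ioc (a k : ℝ) (b (k + 1))) =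
        ν (Set.pi Set.univ fun k : Fin (n + 1) => Set.Ioc (a k : ℝ) (b (k + 1)))) :
    μ.restrict (⋃ q : {q : Fin (n + 1) → ℚ≥0 // Monotone q},
        Set.pi Set.univ fun k : Fin (n + 1) =>
          Set.Ioc (gridPoint q.1 k : ℝ) (gridPoint q.1 (k + 1))) =
      ν.restrict (⋃ q : {q : Fin (n + 1) → ℚ≥0 // Monotone q},
        Set.pi Set.univ fun k : Fin (n + 1) =>
          Set.Ioc (gridPoint q.1 k : ℝ) (gridPoint q.1 (k + 1))) := by
  rw [Measure.restrict_iUnion_congr]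
  rintro ⟨q, hq⟩
  have hg := monotone_gridPoint hq
  set b := gridPoint q with hb
  have hgen : (MeasurableSpace.pi : MeasurableSpace (Fin (n + 1) → ℝ)) =
      MeasurableSpace.generateFrom
        (Set.pi Set.univ '' Set.pi Set.univ fun _ : Fin (n + 1) => Set.range (Set.Iic (α := ℝ))) := by
    rw [← generateFrom_pi_eq]
    · congr 1
      ext1 k
      exact (BorelSpace.measurable_eq (α := ℝ)).trans (borel_eq_generateFrom_Iic ℝ)
    · intro k
      refine ⟨fun m => Set.Iic (m : ℝ), fun m => ⟨m, rfl⟩, ?_⟩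
      exact Set.eq_univ_of_forall fun x => Set.mem_iUnion.2 (exists_nat_ge x)
  refine ext_of_generate_finite _ hgen (IsPiSystem.pi fun _ => isPiSystem_Iic) ?_ ?_
  · rintro _ ⟨s, hs, rfl⟩
    choose x hx using fun k => hs k (Set.mem_univ k)
    obtain rfl : (fun k => Set.Iic (x k)) = s := funext hx
    have hms : MeasurableSet (Set.pi Set.univ fun k => Set.Iic (x k)) :=
      MeasurableSet.univ_pi fun k => measurableSet_Iic
    rw [Measure.restrict_apply hms, Measure.restrict_apply hms, ← Set.pi_inter_distrib]
    by_cases hxb : ∀ k : Fin (n + 1), (b k : ℝ) ≤ x k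
    -- Cutting the box by the orthant below x lowers its upper corners to min(b (k + 1), x k). The
    -- result is again an ordered box, now with lower corners b and upper corners from c, so the
    -- hypothesis applies to it.
    · let c : ℕ → ℝ≥0 := fun r => match r with
        | 0 => 0
        | k + 1 => if hk : k < n + 1 then min (b (k + 1)) (x ⟨k, hk⟩).toNNReal else b (k + 1)
      have hcb : ∀ k, c k ≤ b k := by
        intro k
        cases k with
        | zero => exact zero_le
        | succ k =>
          simp only [c]
          split_ifs
          · exact min_le_left _ _
          · exact le_rfl
      have hbc : ∀ k, b k ≤ c (k + 1) := by
        intro k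
        simp only [c]
        split_ifs with hk
        · exact le_min (hg k.le_succ) (NNReal.le_toNNReal_of_coe_le (hxb ⟨k, hk⟩))
        · exact hg k.le_succ
      have hset : (Set.pi Set.univ fun k : Fin (n + 1) =>
          Set.Iic (x k) ∩ Set.Ioc (b k : ℝ) (b (k + 1))) =
          Set.pi Set.univ fun k : Fin (n + 1) => Set.Ioc (b k : ℝ) (c (k + 1)) := by
        refine Set.pi_congr rfl fun k _ => ?_
        have hc : (c (k + 1) : ℝ) = min (b (k + 1) : ℝ) (x k) := by
          simp only [c, k.isLt, dif_pos, NNReal.coe_min]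
          rw [Real.coe_toNNReal _ ((NNReal.coe_nonneg _).trans (hxb k))]
        rw [hc]
        ext y
        simp only [Set.mem_inter_iff, Set.mem_Iic, Set.mem_Ioc, le_min_iff]
        tauto
      rw [hset]
      exact h b c rfl hcb hbc
    · push Not at hxb
      obtain ⟨k, hk⟩ := hxb
      have hempty : (Set.pi Set.univ fun k : Fin (n + 1) =>
          Set.Iic (x k) ∩ Set.Ioc (b k : ℝ) (b (k + 1))) = ∅ := by
        refine Set.univ_pi_eq_empty_iff.2 ⟨k, ?_⟩
        refine Set.eq_empty_of_forall_notMem fun y hy => ?_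
        exact absurd (hy.2.1.trans_le hy.1) hk.not_gt
      rw [hempty, measure_empty, measure_empty]
  · rw [Measure.restrict_apply_univ, Measure.restrict_apply_univ]
    exact h b b rfl (fun _ => le_rfl) fun k => hg k.le_succ

end PartialSums

/-- The total time spent at the levels `0, …, k`, for every `k ≤ n`. -/
noncomputable def exitTimes {E Ω : Type*} (ℓ : E → ℕ) (X : ℝ≥0 → Ω → E) (n : ℕ) (ω : Ω) (k : Fin n) : ℝ :=
  (∑ l ∈ Finset.range (k + 1), levelTime ℓ (X · ω) l).toReal

/-- The box conditions say that the level is at least k at time b k and at most k at time a k. As b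
k ≤ a k and the level is nondecreasing, both are equalities; at the final time the upper bound is
that of the top level. -/
theorem exitTimes_mem_pi_Ioc_iff {E Ω : Type*} [Fintype E] [DecidableEq E] {Λ : Matrix E E ℝ} {ℓ : E → ℕ} {n : ℕ}
    {X : ℝ≥0 → Ω → E} {ω : Ω} (h : IsSequentialGenerator Λ ℓ (n + 1))
    (hmono : Monotone fun t => ℓ (X t ω))
    (hrc : ∀ t : ℝ≥0, ∃ ε : ℝ≥0, 0 < ε ∧ ∀ s, t ≤ s → s < t + ε → X s ω = X t ω)
    {a b : ℕ → ℝ≥0} (hba : ∀ k, b k ≤ a k) :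
    exitTimes ℓ X (n + 1) ω ∈
        Set.pi Set.univ (fun k : Fin (n + 1) => Set.Ioc (a k : ℝ) (b (k + 1))) ↔
      ∀ r ≤ 2 * (n + 1), ℓ (X (interleave a b r) ω) = r / 2 := by
  have hmem : exitTimes ℓ X (n + 1) ω ∈
        Set.pi Set.univ (fun k : Fin (n + 1) => Set.Ioc (a k : ℝ) (b (k + 1))) ↔
      ∀ k < n + 1, ℓ (X (a k) ω) ≤ k ∧ k < ℓ (X (b (k + 1)) ω) := by
    simp only [Set.mem_univ_pi, exitTimes, toReal_sum_levelTime_mem_Ioc_iff hmono hrc,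
      Fin.forall_iff]
  rw [hmem]
  constructor
  · intro hk
    have hlow : ∀ k ≤ n + 1, k ≤ ℓ (X (b k) ω) := by
      intro k hkn
      cases k with
      | zero => exact Nat.zero_le _
      | succ k => exact (hk k (by omega)).2
    intro r hr
    obtain ⟨m, rfl | rfl⟩ := Nat.even_or_odd' r
    · rw [interleave_two_mul, Nat.mul_div_cancel_left m two_pos]
      refine le_antisymm ?_ (hlow m (by omega))
      rcases Nat.lt_or_ge m (n + 1) with hm | hm
      · exact (hmono (hba m)).trans (hk m hm).1
      · exact (h.level_le _).trans hm
    · rw [interleave_two_mul_add_one, show (2 * m + 1) / 2 = m by omega]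
      exact le_antisymm (hk m (by omega)).1 ((hlow m (by omega)).trans (hmono (hba m)))
  · intro hr k hk
    have h1 := hr (2 * k + 1) (by omega)
    have h2 := hr (2 * (k + 1)) (by omega)
    rw [interleave_two_mul_add_one] at h1
    rw [interleave_two_mul] at h2
    omega

/-! ### The law of the occupation times -/

section OccupationLaw

variable {E : Type*} [Fintype E] [DecidableEq E] {Ω : Type*} [MeasurableSpace Ω]
  {P : Measure Ω} {Λ : Matrix E E ℝ} {ℓ : E → ℕ} {n : ℕ} {π : E → ℝ}
  {X : ℝ≥0 → Ω → E}

/-- The measure on `ℝⁿ` with the path density. -/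
noncomputable def pathMeasure (Λ : Matrix E E ℝ) (ℓ : E → ℕ) (π : E → ℝ) (n : ℕ) :
    Measure (Fin n → ℝ) :=
  (volume : Measure (Fin n → ℝ)).withDensity
    ({y | ∀ k, 0 ≤ y k}.indicator fun y => ENNReal.ofReal (∑ j, pathRow Λ ℓ π n y j))

theorem measurableSet_forall_nonneg (n : ℕ) : MeasurableSet {y : Fin n → ℝ | ∀ k, 0 ≤ y k} := by
  have : {y : Fin n → ℝ | ∀ k, 0 ≤ y k} = ⋂ k, {y | 0 ≤ y k} := by ext; simp
  rw [this]
  exact MeasurableSet.iInter fun k => measurableSet_le measurable_const (measurable_pi_apply k)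

theorem pathMeasure_eq (Λ : Matrix E E ℝ) (ℓ : E → ℕ) (π : E → ℝ) (n : ℕ) :
    pathMeasure Λ ℓ π n = ((volume : Measure (Fin n → ℝ)).restrict
      {y | ∀ k, 0 ≤ y k}).withDensity fun y => ENNReal.ofReal (∑ j, pathRow Λ ℓ π n y j) :=
  withDensity_indicator (measurableSet_forall_nonneg n) _

theorem ae_pathMeasure_pos (Λ : Matrix E E ℝ) (ℓ : E → ℕ) (π : E → ℝ) (n : ℕ) :
    ∀ᵐ y ∂pathMeasure Λ ℓ π n, ∀ k, 0 < y k := by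
  rw [pathMeasure_eq]
  refine (withDensity_absolutelyContinuous _ _).ae_le ?_
  refine (ae_restrict_iff' (measurableSet_forall_nonneg n)).2 ?_
  have hne : ∀ k : Fin n, ∀ᵐ y : Fin n → ℝ, y k ≠ 0 := fun k => by
    have := Measure.pi_hyperplane (fun _ : Fin n => (volume : Measure ℝ)) k 0
    exact measure_eq_zero_iff_ae_notMem.1 this
  filter_upwards [ae_all_iff.2 hne] with y hy hy0 k using lt_of_le_of_ne (hy0 k) (hy k).symm

theorem IsSequentialGenerator.isProbabilityMeasure_pathMeasure (h : IsSequentialGenerator Λ ℓ n)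
    (hπ : ∀ i, ℓ i ≠ 0 → π i = 0) (hπ0 : ∀ i, 0 ≤ π i) (hπ1 : ∑ i, π i = 1) :
    IsProbabilityMeasure (pathMeasure Λ ℓ π n) := by
  refine ⟨?_⟩
  rw [pathMeasure_eq, withDensity_apply _ MeasurableSet.univ, Measure.restrict_univ,
    h.setLIntegral_nonneg_pathRow hπ hπ0 le_rfl, hπ1, ENNReal.ofReal_one]

theorem IsSequentialGenerator.pathMeasure_sumBox (h : IsSequentialGenerator Λ ℓ n)
    (hπ : ∀ i, ℓ i ≠ 0 → π i = 0) (hπ0 : ∀ i, 0 ≤ π i) {a b : ℕ → ℝ} (hb : b 0 = 0)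
    (hba : ∀ k, b k ≤ a k) (hab : ∀ k, a k ≤ b (k + 1)) :
    pathMeasure Λ ℓ π n (sumBox a b n) = ENNReal.ofReal (∑ j, gridRow Λ ℓ π a b n j) := by
  have hsub : sumBox a b n ⊆ {y | ∀ k, 0 ≤ y k} := fun y hy => nonneg_of_mem_sumBox hb hba hy
  rw [pathMeasure_eq, withDensity_apply _ (measurableSet_sumBox a b n),
    Measure.restrict_restrict_of_subset hsub, h.setLIntegral_sumBox hπ hπ0 hb hba hab]

namespace IsMarkovJumpProcess

theorem initial_nonneg (hX : IsMarkovJumpProcess P Λ π X) (i : E) : 0 ≤ π i :=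
  hX.initial i ▸ measureReal_nonneg

theorem sum_initial [IsProbabilityMeasure P] (hX : IsMarkovJumpProcess P Λ π X) : ∑ i, π i = 1 := by
  simp only [← hX.initial]
  rw [← measureReal_biUnion_finset]
  · convert probReal_univ (μ := P)
    ext
    simp
  · intro i _ i' _ hii
    exact Set.disjoint_left.2 fun ω h1 h2 => hii (h1.symm.trans h2)
  · exact fun i _ => hX.measurable 0 i

/-- Nothing is assumed about paths in the exceptional null set, so measurability is obtained modulo
P: the event that the exit time exceeds t agrees almost surely with an event about the state at time
t. -/
theorem aemeasurable_exitTimes [IsProbabilityMeasure P] (hX : IsMarkovJumpProcess P Λ π X)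
    (h : IsSequentialGenerator Λ ℓ n) (m : ℕ) : AEMeasurable (exitTimes ℓ X m) P := by
  refine aemeasurable_pi_lambda _ fun k => AEMeasurable.ennreal_toReal ?_
  refine NullMeasurable.aemeasurable ?_
  refine @measurable_of_Ioi ℝ≥0∞ (NullMeasurableSpace Ω P) _ _ _ _ _ _ _ _ fun t => ?_
  induction t with
  | top =>
    rw [Set.Ioi_top]
    exact @MeasurableSet.empty (NullMeasurableSpace Ω P) _
  | coe t =>
    have hm : NullMeasurableSet {ω | X t ω ∈ {i | ℓ i ≤ k}} P :=
      (hX.measurableSet_mem t _).nullMeasurableSet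
    refine hm.congr ?_
    filter_upwards [hX.ae_monotone_level h, hX.right_continuous] with ω h1 h2
    exact propext (lt_sum_levelTime_iff h1 h2 k t).symm

variable [IsProbabilityMeasure P]

/-- The laws agree on the cover U by ordered boxes. The path measure is a probability concentrated
on positive vectors, hence gives U mass one; the law of the exit times then does so too, leaving no
room for infinite exit times or empty sojourns. -/
theorem map_exitTimes (hX : IsMarkovJumpProcess P Λ π X)
    (h : IsSequentialGenerator Λ ℓ (n + 1)) (hπ : ∀ i, ℓ i ≠ 0 → π i = 0) :
    P.map (exitTimes ℓ X (n + 1)) = (pathMeasure Λ ℓ π (n + 1)).map partialSums ∧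
      ∀ᵐ ω ∂P, ∀ k, 0 < exitTimes ℓ X (n + 1) ω k := by
  have hT := hX.aemeasurable_exitTimes h (n + 1)
  have hν := h.isProbabilityMeasure_pathMeasure hπ hX.initial_nonneg hX.sum_initial
  have hμ : IsProbabilityMeasure (P.map (exitTimes ℓ X (n + 1))) :=
    Measure.isProbabilityMeasure_map hT
  have hν' : IsProbabilityMeasure ((pathMeasure Λ ℓ π (n + 1)).map partialSums) :=
    Measure.isProbabilityMeasure_map measurable_partialSums.aemeasurable
  have hU := restrict_iUnion_eq_of_pi_Ioc (μ := P.map (exitTimes ℓ X (n + 1)))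
    (ν := (pathMeasure Λ ℓ π (n + 1)).map partialSums) fun a b hb hba hab => by
      have hbox : MeasurableSet (Set.pi Set.univ fun k : Fin (n + 1) =>
          Set.Ioc (a k : ℝ) (b (k + 1))) := MeasurableSet.univ_pi fun k => measurableSet_Ioc
      rw [Measure.map_apply_of_aemeasurable hT hbox, Measure.map_apply measurable_partialSums hbox]
      have hpre : partialSums ⁻¹' (Set.pi Set.univ fun k : Fin (n + 1) =>
          Set.Ioc (a k : ℝ) (b (k + 1))) = sumBox (fun k => a k) (fun k => b k) (n + 1) := by
        ext y
        simp [sumBox, partialSums]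
      rw [hpre, h.pathMeasure_sumBox hπ hX.initial_nonneg (by simp [hb])
        (fun k => NNReal.coe_le_coe.2 (hba k)) (fun k => NNReal.coe_le_coe.2 (hab k)),
        hX.sum_gridRow_eq hπ hb hba hab, ofReal_measureReal]
      refine measure_congr ?_
      filter_upwards [hX.ae_monotone_level h, hX.right_continuous] with ω h1 h2
      exact propext (exitTimes_mem_pi_Ioc_iff h h1 h2 hba)
  set U := ⋃ q : {q : Fin (n + 1) → ℚ≥0 // Monotone q},
    Set.pi Set.univ fun k : Fin (n + 1) =>
      Set.Ioc (gridPoint q.1 k : ℝ) (gridPoint q.1 (k + 1)) with hUdef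
  set μ := P.map (exitTimes ℓ X (n + 1)) with hμdef
  set ν := (pathMeasure Λ ℓ π (n + 1)).map partialSums with hνdef
  have hUm : MeasurableSet U := MeasurableSet.iUnion fun q =>
    MeasurableSet.univ_pi fun k => measurableSet_Ioc
  have hνU : ∀ᵐ t ∂ν, t ∈ U := by
    refine (ae_map_iff measurable_partialSums.aemeasurable hUm).2 ?_
    filter_upwards [ae_pathMeasure_pos Λ ℓ π (n + 1)] with y hy
    obtain ⟨q, hq, hqy⟩ := exists_mem_pi_Ioc_gridPoint hy
    exact Set.mem_iUnion.2 ⟨⟨q, hq⟩, hqy⟩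
  have hμU : ∀ᵐ t ∂μ, t ∈ U := by
    refine (prob_compl_eq_zero_iff hUm).2 ?_
    rw [← Measure.restrict_apply_univ, hU, Measure.restrict_apply_univ]
    exact (prob_compl_eq_zero_iff hUm).1 hνU
  have heq : μ = ν := by
    rw [← Measure.restrict_eq_self_of_ae_mem hμU, hU, Measure.restrict_eq_self_of_ae_mem hνU]
  refine ⟨heq, ?_⟩
  filter_upwards [ae_of_ae_map hT hμU] with ω hω k
  obtain ⟨q, hq⟩ := Set.mem_iUnion.1 hω
  exact (NNReal.coe_nonneg _).trans_lt (hq k (Set.mem_univ k)).1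

/-- The law of the vector of the times spent at the levels `0, …, n`. -/
theorem map_levelTime (hX : IsMarkovJumpProcess P Λ π X)
    (h : IsSequentialGenerator Λ ℓ (n + 1)) (hπ : ∀ i, ℓ i ≠ 0 → π i = 0) :
    (∀ᵐ ω ∂P, ∀ k : Fin (n + 1), levelTime ℓ (X · ω) k < ∞) ∧
    AEMeasurable (fun ω (k : Fin (n + 1)) => (levelTime ℓ (X · ω) k).toReal) P ∧
    P.map (fun ω (k : Fin (n + 1)) => (levelTime ℓ (X · ω) k).toReal) =
      pathMeasure Λ ℓ π (n + 1) := by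
  obtain ⟨hmap, hpos⟩ := hX.map_exitTimes h hπ
  have hT := hX.aemeasurable_exitTimes h (n + 1)
  have hfin : ∀ᵐ ω ∂P, ∀ k : Fin (n + 1), levelTime ℓ (X · ω) k < ∞ := by
    filter_upwards [hpos] with ω hω k
    have := (ENNReal.toReal_pos_iff.1 (hω k)).2
    exact (Finset.single_le_sum (f := levelTime ℓ (X · ω)) (fun _ _ => zero_le)
      (Finset.mem_range.2 (Nat.lt_succ_self k))).trans_lt this
  have hY : increments ∘ exitTimes ℓ X (n + 1) =ᵐ[P]
      fun ω (k : Fin (n + 1)) => (levelTime ℓ (X · ω) k).toReal := by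
    filter_upwards [hfin] with ω hω
    have : exitTimes ℓ X (n + 1) ω =
        partialSums fun k : Fin (n + 1) => (levelTime ℓ (X · ω) k).toReal := by
      ext k
      have hmap : Finset.range (k + 1) = (Finset.Iic k).map Fin.valEmbedding := by
        ext i
        simp only [Finset.mem_range, Finset.mem_map, Finset.mem_Iic, Fin.valEmbedding_apply]
        constructor
        · exact fun hi => ⟨⟨i, by omega⟩, Fin.le_def.2 (by simp; omega), rfl⟩
        · rintro ⟨i, hi, rfl⟩
          exact Nat.lt_succ_of_le hi
      rw [exitTimes, hmap, Finset.sum_map]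
      exact ENNReal.toReal_sum fun i _ => (hω i).ne
    rw [Function.comp_apply, this, increments_partialSums]
  refine ⟨hfin, (measurable_increments.comp_aemeasurable hT).congr hY, ?_⟩
  rw [← Measure.map_congr hY, ← AEMeasurable.map_map_of_aemeasurable
    measurable_increments.aemeasurable hT, hmap,
    Measure.map_map measurable_increments measurable_partialSums]
  convert Measure.map_id
  exact funext increments_partialSums

end IsMarkovJumpProcess

end OccupationLaw

/-! ### From levels back to blocks -/

section BlockModel

variable {n : ℕ} {S : Fin (n + 1) → Type*}

/-- The index of the block of a state; the absorbing state has index `n`. -/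
def level : State S → ℕ
  | none => n
  | some x => x.1

theorem level_none : level (none : State S) = n := rfl

theorem level_some (k : Fin n) (i : S k.castSucc) : level (some ⟨k, i⟩ : State S) = k := rfl

theorem setOf_level_eq (k : Fin n) : {x : State S | level x = k} = block S k := by
  ext x
  rcases x with _ | ⟨l, i⟩
  · simp [level, block, k.isLt.ne']
  · simp only [level, block, Set.mem_ofPred_eq, Option.some.injEq]
    constructor
    · intro h
      obtain rfl := Fin.ext h
      exact ⟨i, rfl⟩
    · rintro ⟨j, hj⟩
      exact congrArg (fun x => (x.1 : ℕ)) hj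

theorem init_eq_zero (α : S 0 → ℝ) {x : State S} (hx : level x ≠ 0) : init α x = 0 := by
  rcases x with _ | ⟨k, i⟩
  · rfl
  · have : k.castSucc ≠ 0 := fun h => hx (congrArg Fin.val h)
    simp [init, this]

variable [∀ k, Fintype (S k)] {α : S 0 → ℝ}
  {A : ∀ k : Fin n, Matrix (S k.castSucc) (S k.castSucc) ℝ}
  {D : ∀ k : Fin n, Matrix (S k.castSucc) (S k.succ) ℝ}

@[simp] theorem gen_block (k : Fin n) (i j : S k.castSucc) :
    gen A D (some ⟨k, i⟩) (some ⟨k, j⟩) = A k i j := by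
  simp [gen]

theorem gen_eq_zero {x y : State S} (h1 : level y ≠ level x) (h2 : level y ≠ level x + 1) :
    gen A D x y = 0 := by
  rcases x with _ | ⟨k, i⟩
  · rfl
  rcases y with _ | ⟨l, j⟩
  · have : k.succ ≠ Fin.last n := fun h => h2 (by simpa [level] using (congrArg Fin.val h).symm)
    simp [gen, this]
  · have h1' : l.castSucc ≠ k.castSucc := fun h =>
      h1 (by simpa [level] using congrArg Fin.val h)
    have h2' : l.castSucc ≠ k.succ := fun h => h2 (by simpa [level] using congrArg Fin.val h)
    simp only [gen, h1', h2', dif_neg, not_false_eq_true]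

/-- A sum over the states that vanishes outside of the `k`-th block. -/
theorem sum_eq_sum_block (k : Fin n) (f : State S → ℝ) (hf : ∀ x, level x ≠ k → f x = 0) :
    ∑ x, f x = ∑ i : S k.castSucc, f (some ⟨k, i⟩) := by
  have h0 : f none = 0 := hf none (by simp [level, k.isLt.ne'])
  rw [Fintype.sum_option, h0, zero_add, Fintype.sum_sigma]
  refine Finset.sum_eq_single k (fun l _ hl => ?_) (by simp)
  exact Finset.sum_eq_zero fun i _ => hf _ fun h => hl (Fin.ext h)

theorem vecMul_exitRate_apply (v : State S → ℝ) (k : Fin n) (y : State S) :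
    (v ᵥ* exitRate (gen A D) level k) y = if level y = k + 1 then
      ∑ i : S k.castSucc, v (some ⟨k, i⟩) * gen A D (some ⟨k, i⟩) y else 0 := by
  rw [vecMul_apply, sum_eq_sum_block k _ fun x hx => by simp [exitRate, hx]]
  split_ifs with hy <;> simp [exitRate, hy, level_some]

variable [∀ k, DecidableEq (S k)]

theorem isSequentialGenerator_gen (hgen : IsGenerator (gen A D))
    (htrans : ∀ (k : Fin n) (i : S k.castSucc), IsTransient (gen A D) (some ⟨k, i⟩)) :
    IsSequentialGenerator (gen A D) level n where
  toIsGenerator := hgen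
  step _ _ := gen_eq_zero
  level_le x := by
    rcases x with _ | ⟨k, i⟩
    · exact le_rfl
    · exact k.isLt.le
  transient x hx := by
    rcases x with _ | ⟨k, i⟩
    · exact absurd hx (lt_irrefl n)
    · exact htrans k i

theorem transition_gen_block (h : IsSequentialGenerator (gen A D) level n) (t : ℝ) (k : Fin n)
    (i j : S k.castSucc) :
    transition (gen A D) t (some ⟨k, i⟩) (some ⟨k, j⟩) = NormedSpace.exp (t • A k) i j := by
  let e : S k.castSucc ↪ State S :=
    ⟨fun i => some ⟨k, i⟩, fun i j hij => by simpa using hij⟩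
  have he : ∀ x : State S, level x = k ↔ x ∈ Set.range e := fun x => by
    have : x ∈ block S k ↔ x ∈ Set.range e := by
      simp only [block, Set.mem_ofPred_eq, Set.mem_range, eq_comm]
      rfl
    rw [← this, ← setOf_level_eq]
    rfl
  have hsub : (gen A D).submatrix e e = A k := by
    ext i j
    exact gen_block k i j
  rw [← hsub]
  exact transition_apply_of_level_eq h.blockTriangular e k he t i j

/-- In block form, passing through block `k` multiplies by `e^{tA_k}`. -/
theorem vecMul_transition_block (h : IsSequentialGenerator (gen A D) level n) {k : Fin n}
    {v : State S → ℝ} (hv : ∀ x, level x ≠ k → v x = 0) (t : ℝ) (i : S k.castSucc) :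
    (v ᵥ* transition (gen A D) t) (some ⟨k, i⟩) =
      ((fun i => v (some ⟨k, i⟩)) ᵥ* NormedSpace.exp (t • A k)) i := by
  rw [vecMul_apply, sum_eq_sum_block k _ fun x hx => by rw [hv x hx, zero_mul], vecMul_apply]
  simp only [transition_gen_block h]

/-- The row before the k-th exponential is supported on block k, and the exit rates read only block
k of the result. So only the diagonal block of the exponential enters, and the exit rates into block
k + 1 are D k. -/
theorem pathRow_eq_rowProd (h : IsSequentialGenerator (gen A D) level n) (y : Fin n → ℝ)
    {m : ℕ} (hm : m < n) (i : S (⟨m, hm⟩ : Fin n).castSucc) :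
    pathRow (gen A D) level (init α) m (fun l => y (Fin.castLE hm.le l)) (some ⟨⟨m, hm⟩, i⟩) =
      rowProd α A D y (⟨m, hm⟩ : Fin n).castSucc i := by
  induction m with
  | zero =>
    have : (⟨0, hm⟩ : Fin n).castSucc = 0 := rfl
    simp only [pathRow, init, this, dif_pos]
    rfl
  | succ m ih =>
    have hm' : m < n := by omega
    let k : Fin n := ⟨m, hm'⟩
    have hrow : rowProd α A D y (⟨m + 1, hm⟩ : Fin n).castSucc =
      (rowProd α A D y k.castSucc ᵥ* NormedSpace.exp (y k • A k)) ᵥ* D k := rfl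
    have hentry : ∀ i' : S k.castSucc,
        gen A D (some ⟨k, i'⟩) (some ⟨⟨m + 1, hm⟩, i⟩) = D k i' i := by
      intro i'
      have h1 : (⟨m + 1, hm⟩ : Fin n).castSucc ≠ k.castSucc := fun hc => by
        have := congrArg Fin.val hc
        simp [k] at this
      have h2 : (⟨m + 1, hm⟩ : Fin n).castSucc = k.succ := rfl
      simp only [gen, h1, dif_neg, not_false_eq_true]
      rw [dif_pos h2]
      rfl
    rw [hrow, pathRow, vecMul_apply (M := D k)]
    refine (vecMul_exitRate_apply _ k _).trans ?_
    refine (if_pos rfl).trans ?_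
    refine Finset.sum_congr rfl fun i' _ => ?_
    have hs : ∀ x, level x ≠ k → pathRow (gen A D) level (init α) m
        (Fin.init fun l => y (Fin.castLE hm.le l)) x = 0 :=
      fun x hx => pathRow_eq_zero (fun _ => init_eq_zero α) _ hx
    refine congrArg₂ (· * ·) ((vecMul_transition_block h hs _ i').trans ?_) (hentry i')
    refine congrArg (fun v => (v ᵥ* NormedSpace.exp (y k • A k)) i') ?_
    exact funext fun i'' => ih hm' i''

end BlockModel

section BlockDensity

variable {n : ℕ} {S : Fin (n + 2) → Type*} [∀ k, Fintype (S k)] [∀ k, DecidableEq (S k)]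
  {α : S 0 → ℝ}
  {A : ∀ k : Fin (n + 1), Matrix (S k.castSucc) (S k.castSucc) ℝ}
  {D : ∀ k : Fin (n + 1), Matrix (S k.castSucc) (S k.succ) ℝ}

theorem sum_pathRow_eq_jointDensity (h : IsSequentialGenerator (gen A D) level (n + 1))
    (y : Fin (n + 1) → ℝ) :
    ∑ x, pathRow (gen A D) level (init α) (n + 1) y x = jointDensity α A D y := by
  let k : Fin (n + 1) := Fin.last n
  -- The top level consists of the absorbing state alone, and its incoming rates are the row sums of
  -- the last D; this supplies the final factor 1.
  have hnone : ∀ i : S k.castSucc, gen A D (some ⟨k, i⟩) none = ∑ j, D k i j := fun i => by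
    simp [gen, k]
  have hrow : rowProd α A D y (Fin.last (n + 1)) =
    (rowProd α A D y k.castSucc ᵥ* NormedSpace.exp (y k • A k)) ᵥ* D k := rfl
  have hsome : ∀ x, pathRow (gen A D) level (init α) (n + 1) y (some x) = 0 := fun x =>
    pathRow_eq_zero (fun _ => init_eq_zero α) y (show level (some x) ≠ n + 1 from x.1.isLt.ne)
  rw [Fintype.sum_option, Finset.sum_eq_zero fun x _ => hsome x, add_zero,
    jointDensity, hrow, ← Matrix.dotProduct_mulVec, pathRow]
  refine (vecMul_exitRate_apply _ k none).trans ?_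
  refine (if_pos rfl).trans ?_
  refine Finset.sum_congr rfl fun i _ => ?_
  have hs : ∀ x, level x ≠ k → pathRow (gen A D) level (init α) n (Fin.init y) x = 0 :=
    fun x hx => pathRow_eq_zero (fun _ => init_eq_zero α) _ hx
  refine congrArg₂ (· * ·) ((vecMul_transition_block h hs _ i).trans ?_) ((hnone i).trans ?_)
  · refine congrArg (fun v => (v ᵥ* NormedSpace.exp (y k • A k)) i) ?_
    exact funext fun i' => pathRow_eq_rowProd h y (Nat.lt_succ_self n) i'
  · simp only [mulVec_apply, Pi.one_apply, mul_one]
    rfl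

end BlockDensity

end MultPH

theorem mainTheorem1 {n : ℕ} (hn : 1 ≤ n) {S : Fin (n + 1) → Type*}
    [∀ k, Fintype (S k)] [∀ k, DecidableEq (S k)]
    (α : S 0 → ℝ)
    (A : ∀ k : Fin n, Matrix (S k.castSucc) (S k.castSucc) ℝ)
    (D : ∀ k : Fin n, Matrix (S k.castSucc) (S k.succ) ℝ)
    (hgen : MultPH.IsGenerator (MultPH.gen A D))
    (htrans : ∀ (k : Fin n) (i : S k.castSucc),
      MultPH.IsTransient (MultPH.gen A D) (some ⟨k, i⟩))
    {Ω : Type*} [MeasurableSpace Ω] (P : Measure Ω) [IsProbabilityMeasure P]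
    (X : ℝ≥0 → Ω → MultPH.State S)
    (hX : MultPH.IsMarkovJumpProcess P (MultPH.gen A D) (MultPH.init α) X)
    (Y : Ω → Fin n → ℝ)
    (hY : ∀ ω k, Y ω k = (MultPH.occupation X k ω).toReal) :
    (∀ᵐ ω ∂P, ∀ k, MultPH.occupation X k ω < ∞) ∧
    (∀ y : Fin n → ℝ, (∀ k, 0 ≤ y k) → 0 ≤ MultPH.jointDensity α A D y) ∧
    AEMeasurable Y P ∧
    P.map Y = (volume : Measure (Fin n → ℝ)).withDensity
      ({y | ∀ k, 0 ≤ y k}.indicator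
        fun y => ENNReal.ofReal (MultPH.jointDensity α A D y)) := by
  obtain ⟨n, rfl⟩ := Nat.exists_eq_succ_of_ne_zero (Nat.one_le_iff_ne_zero.1 hn)
  have h := MultPH.isSequentialGenerator_gen hgen htrans
  have hπ : ∀ x, MultPH.level x ≠ 0 → MultPH.init α x = 0 := fun _ => MultPH.init_eq_zero α
  have hocc : ∀ ω (k : Fin (n + 1)),
      MultPH.levelTime MultPH.level (X · ω) k = MultPH.occupation X k ω := fun ω k => by
    rw [MultPH.levelTime, MultPH.occupation, MultPH.setOf_level_eq]
  have hYeq : Y = fun ω (k : Fin (n + 1)) =>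
      (MultPH.levelTime MultPH.level (X · ω) k).toReal := by
    ext ω k
    rw [hY, hocc]
  obtain ⟨hfin, hmeas, hmap⟩ := hX.map_levelTime h hπ
  refine ⟨?_, fun y hy => ?_, hYeq ▸ hmeas, ?_⟩
  · filter_upwards [hfin] with ω hω k
    rw [← hocc]
    exact hω k
  · rw [← MultPH.sum_pathRow_eq_jointDensity h y]
    exact Finset.sum_nonneg fun x _ => h.pathRow_nonneg hX.initial_nonneg hy x
  · rw [hYeq, hmap, MultPH.pathMeasure]
    simp only [MultPH.sum_pathRow_eq_jointDensity h]
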